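/- Let $A$ be a self-adjoint operator, semi-bounded from below, on a complex Hilbert space $\mathcal{H}$, and let $m=\min\sigma(A)$. Let $\mathfrak{a}$ be the quadratic form of $A$, i.e. the closure of the form $(u,v)\mapsto\langle Au,v\rangle$ on $\mathrm{Dom}(A)$, and let $\mathcal{H}_{\mathfrak{a}}$ be the space $\mathrm{Dom}(\mathfrak{a})$ with the norm $\Vert u\Vert_{\mathfrak{a}}=\left(\mathfrak{a}[u,u]-(m-1)\langle u,u\rangle\right)^{1/2}$. Let $a<b$ be real numbers in the resolvent set $\rho(A)$, set $\Delta=[a,b]$, and suppose that $\sigma_{\mathrm{ess}}(A)\cap\Delta=\varnothing$, where $\sigma_{\mathrm{ess}}(A)$ is the spectrum without the isolated eigenvalues of finite multiplicity. Let $E$ be the orthogonal projection of $\mathcal{H}$ onto the subspace $\mathcal{L}(\Delta)$ spanned by the eigenvectors of $A$ with eigenvalues in $\Delta$. Let $(\mathcal{L}_n)_{n\in\mathbb{N}}$ be finite-dimensional subspaces of $\mathcal{H}_{\mathfrak{a}}$ such that for every $u\in\mathcal{H}_{\mathfrak{a}}$ there are $u_n\in\mathcal{L}_n$ with $\Vert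 u-u_n\Vert_{\mathfrak{a}}\to0$. Let $\mathcal{L}_n(\Delta)$ be the span of all $u\in\mathcal{L}_n$ for which there is $\mu\in\Delta$ with $\mathfrak{a}[u,v]=\mu\langle u,v\rangle$ for all $v\in\mathcal{L}_n$, and let $Q_n$ be the orthogonal projection of $\mathcal{H}$ onto $\mathcal{L}_n(\Delta)$. Then for every $u\in\mathcal{H}_{\mathfrak{a}}$ one has $(Q_n-E)u\in\mathcal{H}_{\mathfrak{a}}$ for all $n$, and $\Vert(Q_n-E)u\Vert_{\mathfrak{a}}\to0$ as $n\to\infty$. -/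

import Mathlib

open Filter Topology

noncomputable section

namespace Galerkin

variable {H : Type*} [NormedAddCommGroup H] [InnerProductSpace ℂ H]

/-! ### Spectrum of an unbounded operator -/

/-- The resolvent set of `A`: all `z` such that `A - z : Dom A → H` has a bounded, everywhere
defined two-sided inverse `R`. -/
def resolventSet (A : H →ₗ.[ℂ] H) : Set ℂ :=
  {z | ∃ R : H →L[ℂ] H,
    (∀ x : H, ∃ h : R x ∈ A.domain, A ⟨R x, h⟩ - z • R x = x) ∧
    (∀ u : A.domain, R (A u - z • (u : H)) = u)}

/-- The spectrum of `A`. -/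
def spectrum (A : H →ₗ.[ℂ] H) : Set ℂ := (resolventSet A)ᶜ

/-- The eigenspace `ker (A - z)`, as a subspace of `H`. -/
def eigenspace (A : H →ₗ.[ℂ] H) (z : ℂ) : Submodule ℂ H :=
  (LinearMap.ker (A.toFun - z • A.domain.subtype)).map A.domain.subtype

/-- The discrete spectrum of a self-adjoint operator: the eigenvalues of finite multiplicity that
are isolated points of the spectrum. -/
def discreteSpectrum (A : H →ₗ.[ℂ] H) : Set ℂ :=
  {z | z ∈ spectrum A ∧ (∃ ε > 0, ∀ w ∈ spectrum A, w ≠ z → ε ≤ dist w z) ∧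
    eigenspace A z ≠ ⊥ ∧ FiniteDimensional ℂ (eigenspace A z)}

/-- The essential spectrum of a self-adjoint operator. -/
def essentialSpectrum (A : H →ₗ.[ℂ] H) : Set ℂ := spectrum A \ discreteSpectrum A

/-- `A` is semi-bounded from below. -/
def IsSemibounded (A : H →ₗ.[ℂ] H) : Prop :=
  ∃ c : ℝ, ∀ u : A.domain, c * ‖(u : H)‖ ^ 2 ≤ (inner ℂ (u : H) (A u)).re

/-- The bottom `m = min σ(A)` of the (real) spectrum. -/
def specMin (A : H →ₗ.[ℂ] H) : ℝ := sInf {x : ℝ | (x : ℂ) ∈ spectrum A}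

/-! ### The quadratic form of a semi-bounded self-adjoint operator

The form of `A` is the closure of the form `(u, v) ↦ ⟨A u, v⟩` on `Dom A`. Forms are linear in
the first and conjugate linear in the second variable, whereas `inner ℂ` is conjugate linear in
its first variable: `⟨A u, v⟩` is written `inner ℂ v (A u)`. -/

/-- The sequence `s` in `Dom A` is form convergent to `u`: it converges to `u` in `H` and
`⟨A (s k - s l), s k - s l⟩ → 0` as `k, l → ∞`. -/
def FormConverges (A : H →ₗ.[ℂ] H) (s : ℕ → A.domain) (u : H) : Prop :=
  Tendsto (fun k => (s k : H)) atTop (𝓝 u) ∧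
  Tendsto (fun p : ℕ × ℕ => inner ℂ ((s p.1 - s p.2 : A.domain) : H) (A (s p.1 - s p.2)))
    atTop (𝓝 0)

/-- The form domain `Dom 𝔞`, the underlying set of the Hilbert space `H_𝔞`. -/
def formDomain (A : H →ₗ.[ℂ] H) : Set H := {u | ∃ s : ℕ → A.domain, FormConverges A s u}

/-- `z = lim ⟨A (s k), t k⟩` for some sequences `s`, `t` that are form convergent to `u`, `v`. -/
def IsFormValue (A : H →ₗ.[ℂ] H) (u v : H) (z : ℂ) : Prop :=
  ∃ s t : ℕ → A.domain, FormConverges A s u ∧ FormConverges A t v ∧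
    Tendsto (fun k => inner ℂ (t k : H) (A (s k))) atTop (𝓝 z)

open Classical in
/-- The form `𝔞[u, v]`, for `u` and `v` in the form domain (and the value `0` elsewhere). For a
semi-bounded self-adjoint `A` the limit exists and does not depend on the sequences, see
`exists_isFormValue` and `IsFormValue.unique`. -/
def form (A : H →ₗ.[ℂ] H) (u v : H) : ℂ :=
  if h : ∃ z, IsFormValue A u v z then h.choose else 0

/-- The norm `‖u‖_𝔞 = (𝔞[u, u] - (m - 1) ⟨u, u⟩) ^ (1 / 2)` on the form domain. -/
def formNorm (A : H →ₗ.[ℂ] H) (u : H) : ℝ :=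
  Real.sqrt ((form A u u).re - (specMin A - 1) * ‖u‖ ^ 2)

/-! ### Spectral subspaces -/

/-- The eigenspace `L(Δ)` of `A` that belongs to the interval `Δ = [a, b]`: the closed linear span
of the eigenvectors whose eigenvalue lies in `Δ`. (The span is already closed if `Δ` contains only
finitely many eigenvalues, all of finite multiplicity.) -/
def spectralSubspace (A : H →ₗ.[ℂ] H) (a b : ℝ) : Submodule ℂ H :=
  (⨆ μ ∈ Set.Icc a b, eigenspace A (μ : ℂ)).topologicalClosure

instance [CompleteSpace H] (A : H →ₗ.[ℂ] H) (a b : ℝ) :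
    CompleteSpace (spectralSubspace A a b) :=
  (Submodule.isClosed_topologicalClosure _).completeSpace_coe

/-- The Galerkin spectral subspace `L(Δ)` of the trial space `L`: the span of all `u ∈ L` with
`𝔞[u, v] = μ ⟨u, v⟩` for all `v ∈ L` and some `μ ∈ Δ = [a, b]`. -/
def galerkinSubspace (A : H →ₗ.[ℂ] H) (L : Submodule ℂ H) (a b : ℝ) : Submodule ℂ H :=
  Submodule.span ℂ {u | u ∈ L ∧ ∃ μ ∈ Set.Icc a b, ∀ v ∈ L, form A u v = (μ : ℂ) * inner ℂ v u}

theorem galerkinSubspace_le (A : H →ₗ.[ℂ] H) (L : Submodule ℂ H) (a b : ℝ) :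
    galerkinSubspace A L a b ≤ L :=
  Submodule.span_le.2 fun _ hu => hu.1

instance (A : H →ₗ.[ℂ] H) (L : Submodule ℂ H) [FiniteDimensional ℂ L] (a b : ℝ) :
    FiniteDimensional ℂ (galerkinSubspace A L a b) :=
  Submodule.finiteDimensional_of_le (galerkinSubspace_le A L a b)

/-- The orthogonal projection `E` of `H` onto `L(Δ)`. -/
def spectralProjection [CompleteSpace H] (A : H →ₗ.[ℂ] H) (a b : ℝ) : H →L[ℂ] H :=
  (spectralSubspace A a b).starProjection

/-- The orthogonal projection `Q` of `H` onto the Galerkin spectral subspace of `L`. -/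
def galerkinProjection (A : H →ₗ.[ℂ] H) (L : Submodule ℂ H) [FiniteDimensional ℂ L]
    (a b : ℝ) : H →L[ℂ] H :=
  (galerkinSubspace A L a b).starProjection

/-! ### The form is well defined -/

theorem form_aux_null {V : Type*} [SeminormedAddCommGroup V] [InnerProductSpace ℂ V] {w : ℕ → V}
    (hc : CauchySeq w) (h0 : ∀ k, Tendsto (fun l => inner ℂ (w k) (w l)) atTop (𝓝 0)) :
    Tendsto (fun k => ‖w k‖) atTop (𝓝 0) := by
  obtain ⟨M, hM⟩ := hc.norm_bddAbove
  have hM' : ∀ k, ‖w k‖ ≤ |M| + 1 := fun k =>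
    (hM ⟨k, rfl⟩).trans ((le_abs_self M).trans (by linarith))
  have hpos : 0 < |M| + 1 := by positivity
  rw [Metric.tendsto_atTop]
  intro ε hε
  obtain ⟨N, hN⟩ := Metric.cauchySeq_iff.1 hc (ε ^ 2 / 2 / (|M| + 1)) (by positivity)
  refine ⟨N, fun k hk => ?_⟩
  have key : ‖w k‖ ^ 2 ≤ ε ^ 2 / 2 + 0 := by
    have h1 := (tendsto_const_nhds (x := ε ^ 2 / 2)).add (h0 k).norm
    rw [norm_zero] at h1
    refine ge_of_tendsto h1 (eventually_atTop.2 ⟨N, fun l hl => ?_⟩)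
    have e : inner ℂ (w k) (w k) = inner ℂ (w k) (w k - w l) + inner ℂ (w k) (w l) := by
      rw [← inner_add_right]; simp
    calc ‖w k‖ ^ 2 = ‖inner ℂ (w k) (w k)‖ := by rw [inner_self_eq_norm_sq_to_K]; simp
      _ ≤ ‖inner ℂ (w k) (w k - w l)‖ + ‖inner ℂ (w k) (w l)‖ := by rw [e]; exact norm_add_le _ _
      _ ≤ _ := by
        gcongr
        calc _ ≤ ‖w k‖ * ‖w k - w l‖ := norm_inner_le_norm _ _
          _ ≤ (|M| + 1) * (ε ^ 2 / 2 / (|M| + 1)) := by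
            have := (hN k hk l hl).le
            rw [dist_eq_norm] at this
            exact mul_le_mul (hM' k) this (norm_nonneg _) hpos.le
          _ = ε ^ 2 / 2 := by field_simp
  rw [Real.dist_eq, sub_zero, abs_norm]
  refine lt_of_pow_lt_pow_left₀ 2 hε.le ?_
  nlinarith [pow_pos hε 2]

theorem form_aux_sub {V : Type*} [SeminormedAddCommGroup V] [InnerProductSpace ℂ V]
    {s s' t t' : ℕ → V} (hs' : CauchySeq s') (ht : CauchySeq t)
    (hss : Tendsto (fun k => ‖s k - s' k‖) atTop (𝓝 0))
    (htt : Tendsto (fun k => ‖t k - t' k‖) atTop (𝓝 0)) :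
    Tendsto (fun k => inner ℂ (t k) (s k) - inner ℂ (t' k) (s' k)) atTop (𝓝 0) := by
  obtain ⟨M, hM⟩ := hs'.norm_bddAbove
  obtain ⟨M', hM'⟩ := ht.norm_bddAbove
  have h1 := (hss.const_mul M').add (htt.mul_const M)
  simp only [mul_zero, zero_mul, add_zero] at h1
  refine squeeze_zero_norm (fun k => ?_) h1
  have e : inner ℂ (t k) (s k) - inner ℂ (t' k) (s' k)
      = inner ℂ (t k) (s k - s' k) + inner ℂ (t k - t' k) (s' k) := by
    rw [inner_sub_right, inner_sub_left]; ring
  rw [e]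
  refine (norm_add_le _ _).trans (add_le_add ?_ ?_)
  · exact (norm_inner_le_norm _ _).trans
      (mul_le_mul_of_nonneg_right (hM' ⟨k, rfl⟩) (norm_nonneg _))
  · exact (norm_inner_le_norm _ _).trans
      (mul_le_mul_of_nonneg_left (hM ⟨k, rfl⟩) (norm_nonneg _))

theorem form_aux_cauchy {V : Type*} [SeminormedAddCommGroup V] [InnerProductSpace ℂ V]
    {s t : ℕ → V} (hs : CauchySeq s) (ht : CauchySeq t) :
    CauchySeq (fun k => inner ℂ (t k) (s k)) := by
  obtain ⟨M, hM⟩ := hs.norm_bddAbove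
  obtain ⟨M', hM'⟩ := ht.norm_bddAbove
  rw [cauchySeq_iff_tendsto_dist_atTop_0] at hs ht ⊢
  have h1 := (hs.const_mul M').add (ht.mul_const M)
  simp only [mul_zero, zero_mul, add_zero] at h1
  refine squeeze_zero (fun _ => dist_nonneg) (fun p => ?_) h1
  have e : inner ℂ (t p.1) (s p.1) - inner ℂ (t p.2) (s p.2)
      = inner ℂ (t p.1) (s p.1 - s p.2) + inner ℂ (t p.1 - t p.2) (s p.2) := by
    rw [inner_sub_right, inner_sub_left]; ring
  rw [dist_eq_norm, dist_eq_norm, dist_eq_norm, e]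
  refine (norm_add_le _ _).trans (add_le_add ?_ ?_)
  · exact (norm_inner_le_norm _ _).trans
      (mul_le_mul_of_nonneg_right (hM' ⟨_, rfl⟩) (norm_nonneg _))
  · exact (norm_inner_le_norm _ _).trans
      (mul_le_mul_of_nonneg_left (hM ⟨_, rfl⟩) (norm_nonneg _))

/-- `⟨A u, v⟩ - c ⟨u, v⟩` is a positive semidefinite inner product on `Dom A`. -/
theorem exists_formCore.{w} {H : Type w} [NormedAddCommGroup H] [InnerProductSpace ℂ H]
    [CompleteSpace H] {A : H →ₗ.[ℂ] H} (hA : IsSelfAdjoint A)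
    (hsb : IsSemibounded A) : ∃ (V : Type w) (_ : SeminormedAddCommGroup V)
      (_ : InnerProductSpace ℂ V) (c : ℝ) (e : A.domain →+ V), ∀ u v : A.domain,
      inner ℂ (e u) (e v) = inner ℂ (u : H) (A v) - c * inner ℂ (u : H) (v : H) := by
  obtain ⟨c, hc⟩ := hsb
  have hsym : A.IsFormalAdjoint A := by
    have h := LinearPMap.adjoint_isFormalAdjoint hA.dense_domain
    rwa [LinearPMap.isSelfAdjoint_def.1 hA] at h
  let core : PreInnerProductSpace.Core ℂ A.domain :=
    { inner := fun u v => inner ℂ (u : H) (A v) - c * inner ℂ (u : H) (v : H)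
      conj_inner_symm := fun u v => by
        simp only [map_sub, map_mul, inner_conj_symm, Complex.conj_ofReal]
        congr 1
        exact hsym u v
      re_inner_nonneg := fun u => by
        have h := hc u
        have e : inner ℂ (u : H) (u : H) = ((‖(u : H)‖ ^ 2 : ℝ) : ℂ) := by
          rw [inner_self_eq_norm_sq_to_K]; push_cast; rfl
        rw [e, ← Complex.ofReal_mul, map_sub]
        change 0 ≤ _ - (((c * ‖(u : H)‖ ^ 2 : ℝ) : ℂ)).re
        rw [Complex.ofReal_re]
        exact sub_nonneg.2 h
      add_left := fun u v w => by
        rw [Submodule.coe_add, inner_add_left, inner_add_left]; ring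
      smul_left := fun u v r => by
        rw [Submodule.coe_smul, inner_smul_left, inner_smul_left]; ring }
  exact ⟨A.domain, @InnerProductSpace.Core.toSeminormedAddCommGroup ℂ _ _ _ _ core, InnerProductSpace.ofCore core, c,
    AddMonoidHom.id _, fun u v => rfl⟩

theorem FormConverges.cauchySeq {A : H →ₗ.[ℂ] H} {V : Type*} [SeminormedAddCommGroup V]
    [InnerProductSpace ℂ V] {c : ℝ} {e : A.domain →+ V}
    (he : ∀ u v : A.domain,
      inner ℂ (e u) (e v) = inner ℂ (u : H) (A v) - c * inner ℂ (u : H) (v : H))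
    {s : ℕ → A.domain} {u : H} (hs : FormConverges A s u) : CauchySeq fun k => e (s k) := by
  have h1 := (cauchySeq_iff_tendsto_dist_atTop_0.1 hs.1.cauchySeq)
  have h2 : Tendsto (fun p : ℕ × ℕ => inner ℂ (e (s p.1 - s p.2)) (e (s p.1 - s p.2)))
      atTop (𝓝 0) := by
    have h3 := hs.2.sub (((Complex.continuous_ofReal.tendsto 0).comp (h1.pow 2 |>.trans
      (by simp))).const_mul (c : ℂ))
    simp only [Complex.ofReal_zero, mul_zero, sub_zero] at h3
    refine h3.congr fun p => ?_
    rw [he, inner_self_eq_norm_sq_to_K]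
    simp [dist_eq_norm]
  rw [cauchySeq_iff_tendsto_dist_atTop_0]
  have h3 := (Real.continuous_sqrt.tendsto 0).comp (by simpa using h2.norm)
  rw [Real.sqrt_zero] at h3
  refine h3.congr fun p => ?_
  rw [Function.comp_apply, dist_eq_norm, Real.sqrt_sq (norm_nonneg _)]

theorem FormConverges.tendsto_sub [CompleteSpace H] {A : H →ₗ.[ℂ] H} (hA : IsSelfAdjoint A)
    {V : Type*} [SeminormedAddCommGroup V]
    [InnerProductSpace ℂ V] {c : ℝ} {e : A.domain →+ V}
    (he : ∀ u v : A.domain,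
      inner ℂ (e u) (e v) = inner ℂ (u : H) (A v) - c * inner ℂ (u : H) (v : H))
    {s s' : ℕ → A.domain} {u : H} (hs : FormConverges A s u) (hs' : FormConverges A s' u) :
    Tendsto (fun k => ‖e (s k) - e (s' k)‖) atTop (𝓝 0) := by
  have hsym : A.IsFormalAdjoint A := by
    have h := LinearPMap.adjoint_isFormalAdjoint hA.dense_domain
    rwa [LinearPMap.isSelfAdjoint_def.1 hA] at h
  have hw : Tendsto (fun l => ((s l - s' l : A.domain) : H)) atTop (𝓝 0) := by
    simpa using hs.1.sub hs'.1
  refine form_aux_null (w := fun k => e (s k) - e (s' k))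
    (uniformContinuous_sub.comp_cauchySeq ((hs.cauchySeq he).prodMk (hs'.cauchySeq he))) fun k => ?_
  have h := (tendsto_const_nhds (x := A (s k - s' k))).inner (𝕜 := ℂ) hw
  have h' := (tendsto_const_nhds (x := ((s k - s' k : A.domain) : H))).inner (𝕜 := ℂ) hw
  have h'' := h.sub (h'.const_mul (c : ℂ))
  simp only [inner_zero_right, mul_zero, sub_zero] at h''
  refine h''.congr fun l => ?_
  rw [← map_sub, ← map_sub, he, ← hsym]

theorem IsFormValue.unique [CompleteSpace H] {A : H →ₗ.[ℂ] H} (hA : IsSelfAdjoint A)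
    (hsb : IsSemibounded A) {u v : H} {z z' : ℂ} (hz : IsFormValue A u v z)
    (hz' : IsFormValue A u v z') : z = z' := by
  obtain ⟨V, _, _, c, e, he⟩ := exists_formCore hA hsb
  obtain ⟨s, t, hs, ht, hst⟩ := hz
  obtain ⟨s', t', hs', ht', hst'⟩ := hz'
  have h := form_aux_sub (hs'.cauchySeq he) (ht.cauchySeq he) (hs.tendsto_sub hA he hs')
    (ht.tendsto_sub hA he ht')
  have h' := (hst.sub ((ht.1.inner (𝕜 := ℂ) hs.1).const_mul (c : ℂ))).sub
    (hst'.sub ((ht'.1.inner (𝕜 := ℂ) hs'.1).const_mul (c : ℂ)))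
  have := tendsto_nhds_unique (h.congr fun k => by rw [he, he]) h'
  linear_combination -this

theorem exists_isFormValue [CompleteSpace H] {A : H →ₗ.[ℂ] H} (hA : IsSelfAdjoint A)
    (hsb : IsSemibounded A) {u v : H} (hu : u ∈ formDomain A) (hv : v ∈ formDomain A) :
    ∃ z, IsFormValue A u v z := by
  obtain ⟨V, _, _, c, e, he⟩ := exists_formCore hA hsb
  obtain ⟨s, hs⟩ := hu
  obtain ⟨t, ht⟩ := hv
  obtain ⟨z, hz⟩ := cauchySeq_tendsto_of_complete
    (form_aux_cauchy (hs.cauchySeq he) (ht.cauchySeq he))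
  refine ⟨_, s, t, hs, ht, (hz.add ((ht.1.inner (𝕜 := ℂ) hs.1).const_mul (c : ℂ))).congr
    fun k => ?_⟩
  rw [he]; ring

theorem IsFormValue.form_eq [CompleteSpace H] {A : H →ₗ.[ℂ] H} (hA : IsSelfAdjoint A)
    (hsb : IsSemibounded A) {u v : H} {z : ℂ} (hz : IsFormValue A u v z) : form A u v = z := by
  have h : ∃ z, IsFormValue A u v z := ⟨z, hz⟩
  rw [form, dif_pos h]
  exact h.choose_spec.unique hA hsb hz

theorem form_apply [CompleteSpace H] {A : H →ₗ.[ℂ] H} (hA : IsSelfAdjoint A)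
    (hsb : IsSemibounded A) (u v : A.domain) : form A u v = inner ℂ (v : H) (A u) := by
  have h : ∀ x : A.domain, FormConverges A (fun _ => x) x := fun x =>
    ⟨tendsto_const_nhds, by simp⟩
  exact IsFormValue.form_eq hA hsb
    ⟨fun _ => u, fun _ => v, h u, h v, tendsto_const_nhds⟩

end Galerkin

end

/-!
# Strong convergence of Galerkin spectral projections in the form norm

Everything is carried to bounded operators on `H`. Choose a real `t < a` with `t ≤ m - 1`, and let
`R = (A - t)⁻¹` and `B = R ^ (1 / 2)`. Then `B` maps `H` bijectively onto the form domain, the form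
satisfies `𝔞[B x, B y] = ⟨x, y⟩ + t ⟨B x, B y⟩`, and `x ↦ ‖B x‖_𝔞` is equivalent to the norm of `H`
(`IsResolventSqrt.formNorm_le`, `IsResolventSqrt.norm_le_formNorm`). With `τ = (μ - t)⁻¹`, the
interval `Δ = [a, b]` becomes `[α, β] = [(b - t)⁻¹, (a - t)⁻¹]`, where `α > 0`. Let `χ` be its
characteristic function.

* The points of `σ(R)` in `[α, β]` are isolated and lie in the interior, so `χ` is continuous on
  `σ(R)` and `E = χ(R)` (`IsResolvent.spectralProjection_eq`). In particular `E` commutes with `B`.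
* Let `P` be the projection onto `M = B⁻¹ L` for a trial space `L`. The Galerkin eigenvalue problem
  in `L` is the eigenvalue problem of the compression `T = P R P`
  (`IsResolventSqrt.galerkinSubspace_eq`). Hence `Q B P = B χ(T)`. The remainder `Q B (x - P x)` is
  `B z` with `‖z‖ ≤ C ‖B (x - P x)‖`, because `T ≥ α` on the range of `χ(T)`
  (`IsResolventSqrt.exists_galerkinProjection_apply`).
* Density of the trial spaces means that the projections `P` converge strongly to the identity, so
  that the compressions converge strongly to `R`. It remains to see that `χ(T)` converges strongly
  to `χ(R)` (`tendsto_cfc_indicator_apply`). For a continuous function in place of `χ` this is clear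
  from the Weierstrass theorem. As `α` and `β` are not in `σ(R)`, there are continuous `g ≤ χ ≤ f`
  that agree on `σ(R)`, and `‖(f - χ)(T) x‖ ≤ ‖(f - g)(T) x‖ → ‖(f - g)(R) x‖ = 0`.

The compressions may have spurious eigenvalues in `[α, β]`, also in the limit. The corresponding
spectral projections nevertheless tend to zero strongly, although not in norm.
-/

/-! ### Strong continuity of the functional calculus -/

/-- Functional calculus is continuous for strong convergence of uniformly bounded self-adjoint
operators: this is clear for polynomials, and polynomials approximate `f` uniformly on `[-C, C]`,
an interval that contains all the spectra. -/
theorem tendsto_cfc_apply {H : Type*} [NormedAddCommGroup H] [InnerProductSpace ℂ H]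
    [CompleteSpace H] {T : ℕ → H →L[ℂ] H} {R : H →L[ℂ] H} (hT : ∀ n, IsSelfAdjoint (T n))
    (hR : IsSelfAdjoint R) {C : ℝ} (hTC : ∀ n, ‖T n‖ ≤ C) (hRC : ‖R‖ ≤ C)
    (hlim : ∀ x, Tendsto (fun n => T n x) atTop (𝓝 (R x))) {f : ℝ → ℝ} (hf : Continuous f)
    (x : H) : Tendsto (fun n => cfc f (T n) x) atTop (𝓝 (cfc f R x)) := by
  rcases subsingleton_or_nontrivial H with _ | _
  · exact tendsto_const_nhds.congr fun n => Subsingleton.elim _ _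
  have hC : 0 ≤ C := (norm_nonneg _).trans hRC
  have hpow : ∀ k : ℕ, ∀ x, Tendsto (fun n => (T n ^ k) x) atTop (𝓝 ((R ^ k) x)) := by
    intro k
    induction k with
    | zero => intro x; simp
    | succ k ih =>
      intro x
      have h1 : Tendsto (fun n => (T n ^ k) (T n x - R x)) atTop (𝓝 0) := by
        have h2 := ((hlim x).sub_const (R x)).norm.const_mul (C ^ k)
        rw [sub_self, norm_zero, mul_zero] at h2
        refine squeeze_zero_norm (fun n => ?_) h2
        refine ((T n ^ k).le_opNorm _).trans ?_
        gcongr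
        exact (norm_pow_le _ _).trans (pow_le_pow_left₀ (norm_nonneg _) (hTC n) k)
      have h3 := h1.add (ih (R x))
      rw [zero_add] at h3
      refine h3.congr fun n => ?_
      rw [map_sub, sub_add_cancel, pow_succ]
      rfl
  have hpoly : ∀ (p : Polynomial ℝ) (x : H),
      Tendsto (fun n => (Polynomial.aeval (T n) p) x) atTop (𝓝 ((Polynomial.aeval R p) x)) := by
    intro p x
    induction p using Polynomial.induction_on' with
    | add p q hp hq => simpa using hp.add hq
    | monomial k r =>
      simp only [Polynomial.aeval_monomial, Algebra.algebraMap_eq_smul_one, smul_mul_assoc,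
        one_mul, smul_apply]
      exact (hpow k x).const_smul r
  -- uniform approximation of `cfc f` by a polynomial
  have happrox : ∀ (p : Polynomial ℝ) (ε : ℝ), 0 ≤ ε →
      (∀ y ∈ Set.Icc (-C) C, |p.eval y - f y| ≤ ε) → ∀ S : H →L[ℂ] H, IsSelfAdjoint S →
      ‖S‖ ≤ C → ‖cfc f S x - (Polynomial.aeval S p) x‖ ≤ ε * ‖x‖ := by
    intro p ε hε hp S hS hSC
    rw [← sub_apply, ← cfc_polynomial p S hS, ← cfc_sub f p.eval S
      hf.continuousOn p.continuous.continuousOn]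
    refine (ContinuousLinearMap.le_opNorm _ _).trans ?_
    gcongr
    refine norm_cfc_le hε fun y hy => ?_
    have h := (spectrum.norm_le_norm_of_mem hy).trans hSC
    rw [Real.norm_eq_abs, abs_sub_comm]
    exact hp y (abs_le.1 h)
  rw [Metric.tendsto_atTop]
  intro ε hε
  obtain ⟨p, hp⟩ := exists_polynomial_near_of_continuousOn (-C) C f hf.continuousOn
    (ε / 4 / (‖x‖ + 1)) (by positivity)
  have hδ : ε / 4 / (‖x‖ + 1) * ‖x‖ ≤ ε / 4 := by
    rw [div_mul_eq_mul_div, div_le_iff₀ (by positivity)]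
    nlinarith [norm_nonneg x]
  have hS := happrox p _ (by positivity) fun y hy => (hp y hy).le
  obtain ⟨N, hN⟩ := Metric.tendsto_atTop.1 (hpoly p x) (ε / 4) (by positivity)
  refine ⟨N, fun n hn => ?_⟩
  have h1 := (hS (T n) (hT n) (hTC n)).trans hδ
  have h2 := (hS R hR hRC).trans hδ
  have h3 := hN n hn
  rw [← dist_eq_norm] at h1 h2
  rw [dist_comm] at h2
  linarith [dist_triangle4 (cfc f (T n) x) (Polynomial.aeval (T n) p x)
    (Polynomial.aeval R p x) (cfc f R x)]

/-! ### Spectral projections for isolated parts of the spectrum -/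

/-- The span of the eigenvectors of the bounded operator `T` with eigenvalue in `[α, β]`, not
closed in general. -/
def eigenSpan {H : Type*} [NormedAddCommGroup H] [InnerProductSpace ℂ H]
    (T : H →L[ℂ] H) (α β : ℝ) : Submodule ℂ H :=
  ⨆ τ ∈ Set.Icc α β, Module.End.eigenspace (T : Module.End ℂ H) (τ : ℂ)

/-- `[α, β]` meets the spectrum of `T` in finitely many points, all of them isolated in the
spectrum. Isolation is encoded by closedness of the remaining part of the spectrum. -/
structure FinitelyManyIsolated {H : Type*} [NormedAddCommGroup H] [InnerProductSpace ℂ H]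
    (T : H →L[ℂ] H) (α β : ℝ) : Prop where
  finite : (spectrum ℝ T ∩ Set.Icc α β).Finite
  isClosed : IsClosed (spectrum ℝ T \ Set.Icc α β)

section Isolated

variable {H : Type*} [NormedAddCommGroup H] [InnerProductSpace ℂ H] {T : H →L[ℂ] H} {α β : ℝ}

theorem mem_eigenSpan {x : H} {τ : ℝ} (hτ : τ ∈ Set.Icc α β) (hx : T x = (τ : ℂ) • x) :
    x ∈ eigenSpan T α β :=
  (le_iSup₂_of_le (f := fun τ (_ : τ ∈ Set.Icc α β) =>
    Module.End.eigenspace (T : Module.End ℂ H) (τ : ℂ)) τ hτ le_rfl)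
    (Module.End.mem_eigenspace_iff.2 hx)

theorem eigenSpan_le {K : Submodule ℂ H}
    (h : ∀ τ ∈ Set.Icc α β, ∀ x : H, T x = (τ : ℂ) • x → x ∈ K) : eigenSpan T α β ≤ K :=
  iSup₂_le fun τ hτ _ hx => h τ hτ _ (Module.End.mem_eigenspace_iff.1 hx)

theorem FinitelyManyIsolated.of_finite (h : (spectrum ℝ T).Finite) :
    FinitelyManyIsolated T α β :=
  ⟨h.inter_of_left _, h.sdiff.isClosed⟩

/-- Continuity on the spectrum is no condition at the finitely many isolated points. -/
theorem FinitelyManyIsolated.continuousOn (h : FinitelyManyIsolated T α β) {f : ℝ → ℝ}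
    (hf : ContinuousOn f (spectrum ℝ T \ Set.Icc α β)) : ContinuousOn f (spectrum ℝ T) := by
  rw [← Set.inter_union_sdiff (spectrum ℝ T) (Set.Icc α β)]
  exact (h.finite.continuousOn f).union_of_isClosed hf h.finite.isClosed h.isClosed

theorem FinitelyManyIsolated.continuousOn_indicator (h : FinitelyManyIsolated T α β)
    {s : Set ℝ} (hs : s ⊆ Set.Icc α β) (f : ℝ → ℝ) :
    ContinuousOn (s.indicator f) (spectrum ℝ T) :=
  h.continuousOn ((continuousOn_const (c := (0 : ℝ))).congr fun _ hy =>
    Set.indicator_of_notMem (fun hy' => hy.2 (hs hy')) _)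

variable [CompleteSpace H]

theorem cfc_indicator_apply_of_eigenvector (hT : IsSelfAdjoint T)
    (h : FinitelyManyIsolated T α β) {τ : ℝ} (hτ : τ ∈ Set.Icc α β) {x : H}
    (hx : T x = (τ : ℂ) • x) : cfc ((Set.Icc α β).indicator 1) T x = x := by
  set χ : ℝ → ℝ := (Set.Icc α β).indicator 1 with hχ
  have hc : ContinuousOn χ (spectrum ℝ T) := h.continuousOn_indicator le_rfl _
  -- `1 - χ` is a multiple of `y - τ`
  set g : ℝ → ℝ := (Set.Icc α β)ᶜ.indicator fun y => (y - τ)⁻¹ with hg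
  have hgc : ContinuousOn g (spectrum ℝ T) := by
    refine h.continuousOn (ContinuousOn.congr (f := fun y => (y - τ)⁻¹) ?_ fun y hy =>
      Set.indicator_of_mem hy.2 _)
    exact ContinuousOn.inv₀ (by fun_prop) fun y hy h0 => hy.2 (sub_eq_zero.1 h0 ▸ hτ)
  have e : cfc (fun y => 1 - χ y) T = cfc g T * cfc (fun y => y - τ) T := by
    rw [← cfc_mul g _ T hgc]
    refine cfc_congr fun y _ => ?_
    by_cases hy : y ∈ Set.Icc α β
    · simp [hχ, hg, hy]
    · have : y - τ ≠ 0 := fun h0 => hy (sub_eq_zero.1 h0 ▸ hτ)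
      rw [hχ, hg]
      simp [Set.indicator_of_notMem hy, Set.indicator_of_mem (s := (Set.Icc α β)ᶜ) hy, this]
  rw [cfc_sub (fun _ => (1 : ℝ)) χ T (by fun_prop) hc, cfc_sub _ _ T, cfc_const_one ℝ T,
    cfc_id' ℝ T, cfc_const τ T] at e
  have h0 : (T - algebraMap ℝ (H →L[ℂ] H) τ) x = 0 := by
    rw [Algebra.algebraMap_eq_smul_one, sub_apply, hx]
    exact sub_eq_zero.2 (Complex.coe_smul τ x)
  have e' : x - cfc χ T x = cfc g T ((T - algebraMap ℝ (H →L[ℂ] H) τ) x) :=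
    congrArg (fun S : H →L[ℂ] H => S x) e
  rw [h0, map_zero] at e'
  exact (sub_eq_zero.1 e').symm

theorem cfc_indicator_apply_mem_eigenSpan (hT : IsSelfAdjoint T)
    (h : FinitelyManyIsolated T α β) (x : H) :
    cfc ((Set.Icc α β).indicator 1) T x ∈ eigenSpan T α β := by
  have hc1 : ∀ τ ∈ h.finite.toFinset,
      ContinuousOn (({τ} : Set ℝ).indicator (1 : ℝ → ℝ)) (spectrum ℝ T) := fun τ hτ =>
    h.continuousOn_indicator (Set.singleton_subset_iff.2 (h.finite.mem_toFinset.1 hτ).2) _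
  have e : cfc ((Set.Icc α β).indicator 1) T
      = ∑ τ ∈ h.finite.toFinset, cfc (({τ} : Set ℝ).indicator 1) T := by
    rw [← cfc_sum _ _ _ hc1]
    refine cfc_congr fun y hy => ?_
    rw [Finset.sum_apply]
    by_cases hy' : y ∈ Set.Icc α β
    · rw [Set.indicator_of_mem hy', Finset.sum_eq_single y]
      · simp
      · intro τ _ hτ
        exact Set.indicator_of_notMem (fun h => hτ h.symm) _
      · intro hn
        exact absurd (h.finite.mem_toFinset.2 ⟨hy, hy'⟩) hn
    · rw [Set.indicator_of_notMem hy', Finset.sum_eq_zero]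
      intro τ hτ
      refine Set.indicator_of_notMem (fun hyτ => hy' ?_) _
      rw [Set.mem_singleton_iff.1 hyτ]
      exact (h.finite.mem_toFinset.1 hτ).2
  rw [e, sum_apply]
  refine Submodule.sum_mem _ fun τ hτ => ?_
  have hτ' := (h.finite.mem_toFinset.1 hτ).2
  refine mem_eigenSpan hτ' ?_
  have hc := h.continuousOn_indicator (Set.singleton_subset_iff.2 hτ') 1
  have e' : T * cfc (({τ} : Set ℝ).indicator 1) T = τ • cfc (({τ} : Set ℝ).indicator 1) T := by
    rw [← cfc_const_mul τ _ T hc]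
    conv_lhs => enter [1]; rw [← cfc_id' ℝ T]
    rw [← cfc_mul _ _ T (by fun_prop) hc]
    refine cfc_congr fun y _ => ?_
    by_cases hy : y = τ
    · rw [hy]
    · simp [Set.indicator_of_notMem (s := {τ}) hy]
  rw [Complex.coe_smul]
  exact congrArg (fun S : H →L[ℂ] H => S x) e'

/-- If `[α, β]` contains only isolated points of the spectrum of `T`, then `χ(T)`, with `χ` the
characteristic function of `[α, β]`, is the orthogonal projection onto the span of the eigenvectors
for the eigenvalues in `[α, β]`. -/
theorem starProjection_eq_cfc_indicator (hT : IsSelfAdjoint T)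
    (h : FinitelyManyIsolated T α β) {K : Submodule ℂ H} [K.HasOrthogonalProjection]
    (h1 : eigenSpan T α β ≤ K) (h2 : K ≤ (eigenSpan T α β).topologicalClosure) :
    K.starProjection = cfc ((Set.Icc α β).indicator 1) T := by
  ext x
  have hs : IsSelfAdjoint (cfc ((Set.Icc α β).indicator (1 : ℝ → ℝ)) T) := cfc_predicate _ T
  refine Submodule.eq_starProjection_of_mem_orthogonal
    (h1 (cfc_indicator_apply_mem_eigenSpan hT h x)) ?_
  refine Submodule.orthogonal_le h2 ?_
  rw [Submodule.orthogonal_closure]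
  refine (Submodule.le_orthogonal_orthogonal _).trans (Submodule.orthogonal_le ?_)
    (Submodule.mem_span_singleton_self (R := ℂ) _)
  refine eigenSpan_le fun τ hτ w hw => ?_
  rw [Submodule.mem_orthogonal_singleton_iff_inner_right, inner_sub_left,
    show inner ℂ (cfc ((Set.Icc α β).indicator 1) T x) w = inner ℂ x _ from
      ContinuousLinearMap.isSelfAdjoint_iff_isSymmetric.1 hs x w,
    ContinuousLinearMap.coe_coe, cfc_indicator_apply_of_eigenvector hT h hτ hw, sub_self]

end Isolated

/-! ### Strong convergence of spectral projections -/

/-- Spectral projections for `[α, β]` converge strongly if `α` and `β` are not in the spectrum of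
the limit: the characteristic function of `[α, β]` is squeezed between two continuous functions
that agree on the spectrum of the limit. -/
theorem tendsto_cfc_indicator_apply {H : Type*} [NormedAddCommGroup H] [InnerProductSpace ℂ H]
    [CompleteSpace H] {T : ℕ → H →L[ℂ] H} {R : H →L[ℂ] H} (hT : ∀ n, IsSelfAdjoint (T n))
    (hR : IsSelfAdjoint R) {C : ℝ} (hTC : ∀ n, ‖T n‖ ≤ C) (hRC : ‖R‖ ≤ C)
    (hlim : ∀ x, Tendsto (fun n => T n x) atTop (𝓝 (R x)))
    (hfin : ∀ n, (spectrum ℝ (T n)).Finite) {α β : ℝ} (hα : α ∉ spectrum ℝ R)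
    (hβ : β ∉ spectrum ℝ R) (x : H) :
    Tendsto (fun n => cfc ((Set.Icc α β).indicator 1) (T n) x) atTop
      (𝓝 (cfc ((Set.Icc α β).indicator 1) R x)) := by
  set χ : ℝ → ℝ := (Set.Icc α β).indicator 1 with hχ
  have hσ : IsClosed (spectrum ℝ R) := spectrum.isClosed R
  have hend : ∀ y ∈ spectrum ℝ R, y ∈ Set.Icc α β → y ∈ Set.Ioo α β := fun y hy hy' =>
    ⟨lt_of_le_of_ne hy'.1 fun e => hα (e ▸ hy), lt_of_le_of_ne hy'.2 fun e => hβ (e ▸ hy)⟩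
  obtain ⟨f, hf0, hf1, hf⟩ := exists_continuous_zero_one_of_isClosed
    (hσ.sdiff isOpen_Ioo : IsClosed (spectrum ℝ R \ Set.Ioo α β)) (isClosed_Icc (a := α) (b := β))
    (Set.disjoint_left.2 fun y hy hy' => hy.2 (hend y hy.1 hy'))
  obtain ⟨g, hg0, hg1, hg⟩ := exists_continuous_zero_one_of_isClosed
    (isOpen_Ioo (a := α) (b := β)).isClosed_compl (hσ.inter (isClosed_Icc (a := α) (b := β)))
    (Set.disjoint_left.2 fun y hy hy' => hy (hend y hy'.1 hy'.2))
  have hgχ : ∀ y, g y ≤ χ y := fun y => by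
    by_cases hy : y ∈ Set.Icc α β
    · rw [hχ, Set.indicator_of_mem hy]; exact (hg y).2
    · rw [hg0 fun h => hy (Set.Ioo_subset_Icc_self h)]
      exact Set.indicator_nonneg (fun _ _ => zero_le_one) y
  have hχf : ∀ y, χ y ≤ f y := fun y => by
    by_cases hy : y ∈ Set.Icc α β
    · rw [hf1 hy, hχ, Set.indicator_of_mem hy]
    · rw [hχ, Set.indicator_of_notMem hy]; exact (hf y).1
  have hfσ : ∀ y ∈ spectrum ℝ R, f y = χ y := fun y hy => by
    by_cases hy' : y ∈ Set.Icc α β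
    · rw [hf1 hy', hχ, Set.indicator_of_mem hy']
    · rw [hχ, Set.indicator_of_notMem hy']
      exact hf0 ⟨hy, fun h => hy' (Set.Ioo_subset_Icc_self h)⟩
  have hgσ : ∀ y ∈ spectrum ℝ R, g y = χ y := fun y hy => by
    by_cases hy' : y ∈ Set.Icc α β
    · rw [hg1 ⟨hy, hy'⟩, hχ, Set.indicator_of_mem hy']
    · rw [hχ, Set.indicator_of_notMem hy']
      exact hg0 fun h => hy' (Set.Ioo_subset_Icc_self h)
  have hlf := tendsto_cfc_apply hT hR hTC hRC hlim f.continuous x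
  rw [cfc_congr (g := χ) hfσ] at hlf
  have hlh := tendsto_cfc_apply hT hR hTC hRC hlim (f.continuous.sub g.continuous) x
  rw [cfc_congr (g := fun _ => 0) (fun y hy => by
    rw [Pi.sub_apply, hfσ y hy, hgσ y hy, sub_self]), cfc_const_zero, zero_apply] at hlh
  -- `|f - χ| ≤ f - g`, so `f - χ` is the product of `f - g` and a function bounded by `1`
  have hle : ∀ n, ‖cfc f (T n) x - cfc χ (T n) x‖ ≤ ‖cfc (f - g : ℝ → ℝ) (T n) x‖ := by
    intro n
    have hcont : ∀ φ : ℝ → ℝ, ContinuousOn φ (spectrum ℝ (T n)) := (hfin n).continuousOn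
    have e : cfc f (T n) - cfc χ (T n)
        = cfc (fun y => (f y - χ y) / (f y - g y)) (T n) * cfc (f - g : ℝ → ℝ) (T n) := by
      rw [← cfc_sub f χ (T n) (hcont _) (hcont _), ← cfc_mul _ _ (T n) (hcont _) (hcont _)]
      refine cfc_congr fun y _ => ?_
      rw [Pi.sub_apply]
      rcases eq_or_ne (f y - g y) 0 with h0 | h0
      · have : f y - χ y = 0 := by linarith [hgχ y, hχf y]
        simp [this]
      · exact (div_mul_cancel₀ _ h0).symm
    rw [← sub_apply, e]
    change ‖cfc (fun y => (f y - χ y) / (f y - g y)) (T n) (cfc (f - g : ℝ → ℝ) (T n) x)‖ ≤ _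
    refine (ContinuousLinearMap.le_opNorm _ _).trans ?_
    refine mul_le_of_le_one_left (norm_nonneg _) (norm_cfc_le zero_le_one fun y _ => ?_)
    rw [Real.norm_eq_abs, abs_of_nonneg (div_nonneg (by linarith [hχf y])
      (by linarith [hgχ y, hχf y]))]
    exact div_le_one_of_le₀ (by linarith [hgχ y]) (by linarith [hgχ y, hχf y])
  have h0 := squeeze_zero_norm hle (by simpa using hlh.norm)
  simpa using hlf.sub h0

/-- An operator with finite-dimensional range is annihilated by a nonzero polynomial, so it has
finite spectrum. -/
theorem finite_spectrum_of_range_le {H : Type*} [NormedAddCommGroup H] [InnerProductSpace ℂ H]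
    {T : H →L[ℂ] H} {M : Submodule ℂ H} [FiniteDimensional ℂ M]
    (hM : ∀ x, T x ∈ M) : (spectrum ℝ T).Finite := by
  rcases subsingleton_or_nontrivial H with _ | _
  · have : Subsingleton (H →L[ℂ] H) := ⟨fun S S' => by ext x; exact Subsingleton.elim _ _⟩
    rw [spectrum.of_subsingleton]
    exact Set.finite_empty
  let T' : Module.End ℂ M := (T : Module.End ℂ H).restrict fun x _ => hM x
  have hT' : ∀ (p : Polynomial ℂ) (x : M),
      (((Polynomial.aeval T' p) x : M) : H) = (Polynomial.aeval T p) x := by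
    intro p
    induction p using Polynomial.induction_on' with
    | add p q hp hq => intro x; simp [hp, hq]
    | monomial k r =>
      intro x
      simp only [Polynomial.aeval_monomial, Algebra.algebraMap_eq_smul_one, smul_mul_assoc,
        one_mul, smul_apply, LinearMap.smul_apply, Submodule.coe_smul]
      congr 1
      induction k generalizing x with
      | zero => simp
      | succ k ih => rw [pow_succ, pow_succ]; exact ih (T' x)
  set p := Polynomial.X * minpoly ℂ T' with hp
  have hp0 : p ≠ 0 :=
    mul_ne_zero Polynomial.X_ne_zero (minpoly.ne_zero (Algebra.IsIntegral.isIntegral T'))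
  have hpT : Polynomial.aeval T p = 0 := by
    ext x
    rw [hp, mul_comm, map_mul, Polynomial.aeval_X]
    refine (hT' (minpoly ℂ T') ⟨T x, hM x⟩).symm.trans ?_
    rw [minpoly.aeval]
    rfl
  have hfin : (spectrum ℂ T).Finite := by
    refine (Polynomial.rootSet_finite p ℂ).subset fun z hz => ?_
    rw [Polynomial.mem_rootSet]
    refine ⟨hp0, ?_⟩
    have h := spectrum.subset_polynomial_aeval T p ⟨z, hz, rfl⟩
    rw [hpT, spectrum.zero_eq] at h
    rw [Polynomial.coe_aeval_eq_eval]
    exact h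
  rw [← spectrum.preimage_algebraMap (R := ℝ) ℂ]
  exact hfin.preimage Complex.ofReal_injective.injOn

theorem FinitelyManyIsolated.of_isolated {H : Type*} [NormedAddCommGroup H]
    [InnerProductSpace ℂ H] [CompleteSpace H] {T : H →L[ℂ] H} {α β : ℝ} (hα : α ∉ spectrum ℝ T)
    (hβ : β ∉ spectrum ℝ T)
    (h : ∀ τ ∈ spectrum ℝ T, τ ∈ Set.Icc α β → ∀ᶠ y in 𝓝[≠] τ, y ∉ spectrum ℝ T) :
    FinitelyManyIsolated T α β := by
  have hσ : IsClosed (spectrum ℝ T) := spectrum.isClosed T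
  constructor
  · by_contra hinf
    obtain ⟨τ, hτ, hacc⟩ := Set.Infinite.exists_accPt_of_subset_isCompact hinf
      (isCompact_Icc.inter_left hσ) le_rfl
    refine (accPt_iff_frequently_nhdsNE.1 hacc) ?_
    filter_upwards [h τ hτ.1 hτ.2] with y hy hy'
    exact hy hy'.1
  · have e : spectrum ℝ T \ Set.Icc α β = spectrum ℝ T \ Set.Ioo α β := by
      ext y
      refine and_congr_right fun hy => not_congr ⟨fun hy' => ?_, fun hy' =>
        Set.Ioo_subset_Icc_self hy'⟩
      exact ⟨lt_of_le_of_ne hy'.1 fun e => hα (e ▸ hy), lt_of_le_of_ne hy'.2 fun e => hβ (e ▸ hy)⟩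
    rw [e]
    exact hσ.sdiff isOpen_Ioo

/-- On the spectral subspace for `[α, β]` with `0 < α`, the operator is bounded below by `α`. -/
theorem norm_le_of_mem_eigenSpan {H : Type*} [NormedAddCommGroup H] [InnerProductSpace ℂ H]
    [CompleteSpace H] {T : H →L[ℂ] H} {α β : ℝ} (hT : IsSelfAdjoint T)
    (h : FinitelyManyIsolated T α β) (hα : 0 < α) {x : H} (hx : x ∈ eigenSpan T α β) :
    ‖x‖ ≤ α⁻¹ * ‖T x‖ := by
  have hx' : cfc ((Set.Icc α β).indicator 1) T x = x := by
    have hle : eigenSpan T α β ≤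
        LinearMap.eqLocus (cfc ((Set.Icc α β).indicator 1) T : H →L[ℂ] H).toLinearMap LinearMap.id :=
      eigenSpan_le fun τ hτ y hy => cfc_indicator_apply_of_eigenvector hT h hτ hy
    exact hle hx
  have hc : ContinuousOn ((Set.Icc α β).indicator fun y : ℝ => y⁻¹) (spectrum ℝ T) :=
    h.continuousOn_indicator le_rfl _
  have e : cfc ((Set.Icc α β).indicator 1) T
      = cfc ((Set.Icc α β).indicator fun y : ℝ => y⁻¹) T * T := by
    conv_rhs => enter [2]; rw [← cfc_id' ℝ T]
    rw [← cfc_mul _ _ T hc]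
    refine cfc_congr fun y _ => ?_
    by_cases hy : y ∈ Set.Icc α β
    · simp [hy, (hα.trans_le hy.1).ne']
    · simp [Set.indicator_of_notMem hy]
  have e' : x = cfc ((Set.Icc α β).indicator fun y : ℝ => y⁻¹) T (T x) :=
    hx'.symm.trans (congrArg (fun S : H →L[ℂ] H => S x) e)
  calc ‖x‖ = ‖cfc ((Set.Icc α β).indicator fun y : ℝ => y⁻¹) T (T x)‖ := congrArg norm e'
    _ ≤ _ := ContinuousLinearMap.le_of_opNorm_le _ (norm_cfc_le (by positivity) fun y _ => ?_) _
  by_cases hy : y ∈ Set.Icc α β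
  · rw [Set.indicator_of_mem hy, Real.norm_eq_abs, abs_inv, abs_of_pos (hα.trans_le hy.1)]
    exact inv_anti₀ hα hy.1
  · rw [Set.indicator_of_notMem hy, norm_zero]; positivity

/-! ### Resolvents of semi-bounded self-adjoint operators -/

theorem isUnit_of_isSelfAdjoint_of_bound {H : Type*} [NormedAddCommGroup H]
    [InnerProductSpace ℂ H] [CompleteSpace H] {S : H →L[ℂ] H} (hS : IsSelfAdjoint S)
    {K : NNReal} (hK : ∀ x, ‖x‖ ≤ K * ‖S x‖) : IsUnit S := by
  rw [ContinuousLinearMap.isUnit_iff_bijective,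
    ContinuousLinearMap.bijective_iff_dense_range_and_antilipschitz]
  refine ⟨?_, K, S.antilipschitz_of_bound hK⟩
  rw [Submodule.topologicalClosure_eq_top_iff, Submodule.eq_bot_iff]
  intro x hx
  have h0 : S x = 0 := by
    rw [← inner_self_eq_zero (𝕜 := ℂ)]
    exact (ContinuousLinearMap.isSelfAdjoint_iff_isSymmetric.1 hS x (S x)).trans
      (inner_eq_zero_symm.1 (hx (S (S x)) ⟨_, rfl⟩))
  have h := hK x
  rw [h0, norm_zero, mul_zero] at h
  exact norm_le_zero_iff.1 h

namespace Galerkin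

variable {H : Type*} [NormedAddCommGroup H] [InnerProductSpace ℂ H] {A : H →ₗ.[ℂ] H}

/-- `R` is the resolvent `(A - z)⁻¹`. -/
structure IsResolvent (A : H →ₗ.[ℂ] H) (z : ℂ) (R : H →L[ℂ] H) : Prop where
  mem_domain : ∀ x, R x ∈ A.domain
  right_inv : ∀ x, A ⟨R x, mem_domain x⟩ - z • R x = x
  left_inv : ∀ u : A.domain, R (A u - z • (u : H)) = u

theorem mem_resolventSet_iff {z : ℂ} : z ∈ resolventSet A ↔ ∃ R, IsResolvent A z R :=
  ⟨fun ⟨R, h1, h2⟩ => ⟨R, fun x => (h1 x).1, fun x => (h1 x).2, h2⟩,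
    fun ⟨R, h⟩ => ⟨R, fun x => ⟨h.mem_domain x, h.right_inv x⟩, h.left_inv⟩⟩

namespace IsResolvent

variable {z w : ℂ} {R S : H →L[ℂ] H}

theorem injective (h : IsResolvent A z R) : Function.Injective R := by
  rw [injective_iff_map_eq_zero]
  intro x hx
  rw [← h.right_inv x]
  have : (⟨R x, h.mem_domain x⟩ : A.domain) = 0 := Subtype.ext hx
  rw [this, A.map_zero, hx, smul_zero, sub_zero]

/-- The resolvent identity. -/
theorem sub_eq (hR : IsResolvent A z R) (hS : IsResolvent A w S) :
    S - R = (w - z) • (R * S) := by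
  ext x
  have h := hR.left_inv ⟨S x, hS.mem_domain x⟩
  have e : A ⟨S x, hS.mem_domain x⟩ - z • S x = x + (w - z) • S x := by
    rw [eq_add_of_sub_eq (hS.right_inv x), sub_smul]; abel
  rw [e, map_add, map_smul] at h
  change S x - R x = (w - z) • R (S x)
  exact sub_eq_iff_eq_add'.2 h.symm

theorem map_eigenvector (h : IsResolvent A z R) {u : A.domain} {μ : ℂ} (hμ : μ ≠ z)
    (hu : A u = μ • (u : H)) : R u = (μ - z)⁻¹ • (u : H) := by
  have h' := h.left_inv u
  rw [hu, ← sub_smul, map_smul] at h'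
  rw [← h', smul_smul, inv_mul_cancel₀ (sub_ne_zero.2 hμ), one_smul, h']

theorem apply_of_eigenvector (h : IsResolvent A z R) {x : H} {μ : ℂ} (hμ : μ ≠ z)
    (hx : R x = (μ - z)⁻¹ • x) : ∃ u : A.domain, (u : H) = x ∧ A u = μ • (u : H) := by
  have e : R ((μ - z) • x) = x := by
    rw [map_smul, hx, smul_smul, mul_inv_cancel₀ (sub_ne_zero.2 hμ), one_smul]
  refine ⟨⟨R ((μ - z) • x), h.mem_domain _⟩, e, ?_⟩
  have h' := h.right_inv ((μ - z) • x)
  rw [sub_eq_iff_eq_add] at h'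
  change A ⟨R ((μ - z) • x), _⟩ = μ • R ((μ - z) • x)
  rw [h', e, sub_smul, sub_add_cancel]

theorem notMem_spectrum {t μ : ℝ} (h : IsResolvent A t R) (hμ : (μ : ℂ) ∈ resolventSet A)
    (hne : μ ≠ t) : (μ - t)⁻¹ ∉ _root_.spectrum ℝ R := by
  obtain ⟨S, hS⟩ := mem_resolventSet_iff.1 hμ
  have h0 : ((μ : ℂ) - t) ≠ 0 := sub_ne_zero.2 (by exact_mod_cast hne)
  have h1 := h.sub_eq hS
  have h2 : S - R = ((μ : ℂ) - t) • (S * R) := by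
    rw [← neg_sub R S, hS.sub_eq h, ← neg_smul, neg_sub]
  rw [spectrum.notMem_iff]
  have e : algebraMap ℝ (H →L[ℂ] H) (μ - t)⁻¹ = ((μ : ℂ) - t)⁻¹ • (1 : H →L[ℂ] H) := by
    ext x
    rw [Algebra.algebraMap_eq_smul_one]
    change (μ - t)⁻¹ • x = ((μ : ℂ) - t)⁻¹ • x
    rw [← Complex.coe_smul]
    push_cast
    rfl
  rw [e]
  clear e
  generalize (μ : ℂ) - t = c at h0 h1 h2 ⊢
  refine ⟨⟨_, c • (1 + c • S), ?_, ?_⟩, rfl⟩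
  · simp only [mul_add, sub_mul, mul_smul_comm, smul_mul_assoc, one_mul, mul_one, smul_add,
      smul_sub, smul_smul, mul_inv_cancel₀ h0, mul_inv_cancel_right₀ h0, one_smul]
    linear_combination (norm := module) c • h1
  · simp only [mul_sub, add_mul, mul_smul_comm, smul_mul_assoc, one_mul, mul_one, smul_add,
      smul_smul, inv_mul_cancel₀ h0, inv_mul_cancel_left₀ h0, one_smul]
    linear_combination (norm := module) c • h2

/-- The resolvent at a real point below the spectrum is positive and bounded by the inverse of the
distance to the spectrum. -/
theorem spectrum_subset {t m : ℝ} (h : IsResolvent A t R) (htm : t < m)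
    (hm : ∀ x : ℝ, x < m → (x : ℂ) ∈ resolventSet A) :
    _root_.spectrum ℝ R ⊆ Set.Icc 0 (m - t)⁻¹ := by
  intro y hy
  have key : y ≠ 0 → t + y⁻¹ < m → False := fun h0 hlt => by
    have h' := h.notMem_spectrum (hm _ hlt) (by simpa using h0)
    rw [add_sub_cancel_left, inv_inv] at h'
    exact h' hy
  constructor
  · by_contra! hlt
    exact key hlt.ne (by linarith [inv_lt_zero.2 hlt])
  · by_contra! hlt
    have hpos : 0 < (m - t)⁻¹ := inv_pos.2 (sub_pos.2 htm)
    have := inv_strictAnti₀ hpos hlt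
    rw [inv_inv] at this
    exact key (hpos.trans hlt).ne' (by linarith)

theorem eventually_notMem_spectrum {t τ : ℝ} (h : IsResolvent A t R) (hτ : 0 < τ)
    (hd : ((t + τ⁻¹ : ℝ) : ℂ) ∈ discreteSpectrum A) :
    ∀ᶠ y in 𝓝[≠] τ, y ∉ _root_.spectrum ℝ R := by
  obtain ⟨-, ⟨ε, hε, hsep⟩, -⟩ := hd
  have hcont : Tendsto (fun y : ℝ => y⁻¹) (𝓝[≠] τ) (𝓝 τ⁻¹) :=
    (continuousAt_inv₀ hτ.ne').tendsto.mono_left nhdsWithin_le_nhds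
  filter_upwards [hcont (Metric.ball_mem_nhds _ hε), self_mem_nhdsWithin,
    nhdsWithin_le_nhds (lt_mem_nhds hτ)] with y hy hne hpos hmem
  have hyA : ((t + y⁻¹ : ℝ) : ℂ) ∈ spectrum A := fun hres => by
    have h' := h.notMem_spectrum hres (by simpa using hpos.ne')
    rw [add_sub_cancel_left, inv_inv] at h'
    exact h' hmem
  have h' := hsep _ hyA fun e => hne (inv_injective (add_left_cancel (Complex.ofReal_injective e)))
  have hy' : dist y⁻¹ τ⁻¹ < ε := hy
  rw [Complex.dist_of_im_eq (by simp), Complex.ofReal_re, Complex.ofReal_re, dist_add_left] at h'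
  linarith

theorem isSelfAdjoint [CompleteSpace H] {t : ℝ} (h : IsResolvent A t R)
    (hsym : A.IsFormalAdjoint A) : IsSelfAdjoint R := by
  rw [ContinuousLinearMap.isSelfAdjoint_iff_isSymmetric]
  intro x y
  have h1 := hsym ⟨R x, h.mem_domain x⟩ ⟨R y, h.mem_domain y⟩
  rw [eq_add_of_sub_eq (h.right_inv x), eq_add_of_sub_eq (h.right_inv y)] at h1
  simp only [inner_add_left, inner_add_right, inner_smul_left, inner_smul_right,
    Complex.conj_ofReal] at h1
  exact (add_right_cancel h1).symm

end IsResolvent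

theorem isFormalAdjoint_self [CompleteSpace H] (hA : IsSelfAdjoint A) : A.IsFormalAdjoint A := by
  have h := LinearPMap.adjoint_isFormalAdjoint hA.dense_domain
  rwa [LinearPMap.isSelfAdjoint_def.1 hA] at h

/-- Real points below a lower bound of `A` lie in the resolvent set. Since some real point `a`
does, `A - z = (1 + (a - z) R) (A - a)` with `R = (A - a)⁻¹`, and the first factor is bounded
below and self-adjoint. -/
theorem mem_resolventSet_of_lt [CompleteSpace H] (hsym : A.IsFormalAdjoint A) {c a z : ℝ}
    (hc : ∀ u : A.domain, c * ‖(u : H)‖ ^ 2 ≤ (inner ℂ (u : H) (A u)).re)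
    (ha : (a : ℂ) ∈ resolventSet A) (hz : z < c) : (z : ℂ) ∈ resolventSet A := by
  have hcoer : ∀ u : A.domain, (c - z) * ‖(u : H)‖ ≤ ‖A u - (z : ℂ) • (u : H)‖ := by
    intro u
    rcases eq_or_ne (u : H) 0 with h0 | h0
    · rw [h0, norm_zero, mul_zero]; exact norm_nonneg _
    have h1 : (inner ℂ (u : H) (A u - (z : ℂ) • (u : H))).re
        = (inner ℂ (u : H) (A u)).re - z * ‖(u : H)‖ ^ 2 := by
      rw [inner_sub_right, inner_smul_right, inner_self_eq_norm_sq_to_K, Complex.sub_re,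
        Complex.re_ofReal_mul]
      congr 2
      change (((‖(u : H)‖ : ℝ) : ℂ) ^ 2).re = _
      rw [← Complex.ofReal_pow, Complex.ofReal_re]
    have h2 := (Complex.re_le_norm _).trans
      (norm_inner_le_norm (𝕜 := ℂ) (u : H) (A u - (z : ℂ) • (u : H)))
    refine le_of_mul_le_mul_left ?_ (norm_pos_iff.2 h0)
    nlinarith [hc u]
  obtain ⟨R, hR⟩ := mem_resolventSet_iff.1 ha
  set S : H →L[ℂ] H := 1 + ((a - z : ℝ) : ℂ) • R with hS
  have hRS : ∀ x, A ⟨R x, hR.mem_domain x⟩ - (z : ℂ) • R x = S x := fun x => by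
    change _ = x + ((a - z : ℝ) : ℂ) • R x
    rw [eq_add_of_sub_eq (hR.right_inv x)]
    push_cast
    rw [sub_smul]
    abel
  have hSsa : IsSelfAdjoint S := by
    refine (IsSelfAdjoint.one _).add (IsSelfAdjoint.smul ?_ (hR.isSelfAdjoint hsym))
    exact Complex.conj_ofReal _
  have hcz : 0 < c - z := sub_pos.2 hz
  have hbound : ∀ x, ‖x‖ ≤ (1 + |a - z| / (c - z)) * ‖S x‖ := fun x => by
    have h1 : ‖R x‖ ≤ ‖S x‖ / (c - z) := by
      rw [le_div_iff₀ hcz, mul_comm, ← hRS x]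
      exact hcoer ⟨R x, hR.mem_domain x⟩
    have h2 : x = S x - ((a - z : ℝ) : ℂ) • R x := by
      change x = x + ((a - z : ℝ) : ℂ) • R x - _
      rw [add_sub_cancel_right]
    calc ‖x‖ ≤ ‖S x‖ + ‖((a - z : ℝ) : ℂ) • R x‖ :=
          (congrArg norm h2).le.trans (norm_sub_le _ _)
      _ = ‖S x‖ + |a - z| * ‖R x‖ := by rw [norm_smul, Complex.norm_real, Real.norm_eq_abs]
      _ ≤ ‖S x‖ + |a - z| * (‖S x‖ / (c - z)) := by gcongr
      _ = _ := by ring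
  obtain ⟨U, hU⟩ := isUnit_of_isSelfAdjoint_of_bound hSsa
    (K := ⟨1 + |a - z| / (c - z), by positivity⟩) hbound
  have hmem : ∀ x, (R * ↑U⁻¹ : H →L[ℂ] H) x ∈ A.domain := fun x => hR.mem_domain _
  have hinv : ∀ x, A ⟨(R * ↑U⁻¹ : H →L[ℂ] H) x, hmem x⟩
      - (z : ℂ) • (R * ↑U⁻¹ : H →L[ℂ] H) x = x := fun x => by
    refine (hRS ((↑U⁻¹ : H →L[ℂ] H) x)).trans ?_
    rw [← hU]
    exact congrArg (fun V : H →L[ℂ] H => V x) U.mul_inv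
  refine mem_resolventSet_iff.2 ⟨R * ↑U⁻¹, hmem, hinv, fun u => ?_⟩
  have h1 := hinv (A u - (z : ℂ) • (u : H))
  set v : A.domain := ⟨_, hmem (A u - (z : ℂ) • (u : H))⟩ with hv
  change A v - (z : ℂ) • (v : H) = _ at h1
  have h2 := hcoer (v - u)
  have h3 : A (v - u) - (z : ℂ) • ((v - u : A.domain) : H) = 0 := by
    rw [A.map_sub, Submodule.coe_sub, smul_sub]
    rw [← sub_eq_zero] at h1
    rw [← h1]; abel
  rw [h3, norm_zero] at h2
  have h4 : ‖((v - u : A.domain) : H)‖ ≤ 0 := by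
    by_contra! h; nlinarith
  exact sub_eq_zero.1 (norm_le_zero_iff.1 h4)

theorem mem_resolventSet_of_lt_specMin [CompleteSpace H] (hA : IsSelfAdjoint A)
    (hsb : IsSemibounded A) {a z : ℝ} (ha : (a : ℂ) ∈ resolventSet A) (hz : z < specMin A) :
    (z : ℂ) ∈ resolventSet A := by
  obtain ⟨c, hc⟩ := hsb
  have hbdd : BddBelow {x : ℝ | (x : ℂ) ∈ spectrum A} := ⟨c, fun x hx => by
    by_contra! hlt
    exact hx (mem_resolventSet_of_lt (isFormalAdjoint_self hA) hc ha hlt)⟩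
  exact not_not.1 (notMem_of_lt_csInf hz hbdd)

end Galerkin

/-! ### The form domain as the range of the square root of the resolvent -/

namespace Galerkin

variable {H : Type*} [NormedAddCommGroup H] [InnerProductSpace ℂ H] [CompleteSpace H]
  {A : H →ₗ.[ℂ] H}

/-- `B` is a self-adjoint square root of the resolvent `(A - t)⁻¹`. For `B ≥ 0` this is the
operator `(A - t) ^ (-1 / 2)`. -/
structure IsResolventSqrt (A : H →ₗ.[ℂ] H) (t : ℝ) (B : H →L[ℂ] H) : Prop where
  isSelfAdjoint : IsSelfAdjoint B
  isResolvent : IsResolvent A t (B * B)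

namespace IsResolventSqrt

variable {t : ℝ} {B : H →L[ℂ] H}

theorem inner_left (h : IsResolventSqrt A t B) (x y : H) : inner ℂ (B x) y = inner ℂ x (B y) :=
  ContinuousLinearMap.isSelfAdjoint_iff_isSymmetric.1 h.isSelfAdjoint x y

theorem injective (h : IsResolventSqrt A t B) : Function.Injective B := fun _ _ hxy =>
  h.isResolvent.injective (congrArg B hxy)

theorem denseRange (h : IsResolventSqrt A t B) : DenseRange B := by
  have h0 : (LinearMap.range (B : H →ₗ[ℂ] H)).topologicalClosure = ⊤ := by
    rw [Submodule.topologicalClosure_eq_top_iff, Submodule.eq_bot_iff]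
    intro x hx
    refine (injective_iff_map_eq_zero B).1 h.injective x ?_
    rw [← inner_self_eq_zero (𝕜 := ℂ), h.inner_left]
    exact inner_eq_zero_symm.1 (hx (B (B x)) ⟨_, rfl⟩)
  exact Submodule.dense_iff_topologicalClosure_eq_top.2 h0

/-- The preimage of `u ∈ Dom A` under `B`. -/
def coord (A : H →ₗ.[ℂ] H) (t : ℝ) (B : H →L[ℂ] H) (u : A.domain) : H :=
  B (A u - (t : ℂ) • (u : H))

theorem apply_coord (h : IsResolventSqrt A t B) (u : A.domain) : B (coord A t B u) = u :=
  h.isResolvent.left_inv u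

theorem coord_sub (h : IsResolventSqrt A t B) (u v : A.domain) :
    coord A t B (u - v) = coord A t B u - coord A t B v :=
  h.injective (by rw [map_sub, h.apply_coord, h.apply_coord, h.apply_coord]; rfl)

theorem inner_map (h : IsResolventSqrt A t B) (u v : A.domain) :
    inner ℂ (v : H) (A u)
      = inner ℂ (coord A t B v) (coord A t B u) + t * inner ℂ (v : H) (u : H) := by
  conv_rhs => enter [1]; rw [coord.eq_1 A t B u]
  rw [← h.inner_left, h.apply_coord, inner_sub_right, inner_smul_right, sub_add_cancel]

/-- Form convergence of `s` amounts to norm convergence of the preimages of the `s k` under `B`. -/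
theorem formConverges_iff (h : IsResolventSqrt A t B) {s : ℕ → A.domain} {u : H} :
    FormConverges A s u ↔ ∃ x, u = B x ∧ Tendsto (fun k => coord A t B (s k)) atTop (𝓝 x) := by
  have hinner : ∀ p : ℕ × ℕ, inner ℂ ((s p.1 - s p.2 : A.domain) : H) (A (s p.1 - s p.2))
      = ((dist (coord A t B (s p.1)) (coord A t B (s p.2)) ^ 2
        + t * dist (s p.1 : H) (s p.2 : H) ^ 2 : ℝ) : ℂ) := fun p => by
    rw [h.inner_map, h.coord_sub, inner_self_eq_norm_sq_to_K, inner_self_eq_norm_sq_to_K,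
      dist_eq_norm, dist_eq_norm, Submodule.coe_sub]
    push_cast
    rfl
  constructor
  · rintro ⟨h1, h2⟩
    have h3 := cauchySeq_iff_tendsto_dist_atTop_0.1 h1.cauchySeq
    have h4 : Tendsto (fun p : ℕ × ℕ => dist (coord A t B (s p.1)) (coord A t B (s p.2)) ^ 2)
        atTop (𝓝 0) := by
      have h5 := ((Complex.continuous_re.tendsto 0).comp h2).sub ((h3.pow 2).const_mul t)
      simp only [Complex.zero_re, ne_eq, OfNat.ofNat_ne_zero, not_false_eq_true, zero_pow,
        mul_zero, sub_zero] at h5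
      refine h5.congr fun p => ?_
      rw [Function.comp_apply, hinner, Complex.ofReal_re, add_sub_cancel_right]
    have h5 : CauchySeq fun k => coord A t B (s k) := by
      rw [cauchySeq_iff_tendsto_dist_atTop_0]
      have h6 := (Real.continuous_sqrt.tendsto 0).comp h4
      rw [Real.sqrt_zero] at h6
      exact h6.congr fun p => Real.sqrt_sq dist_nonneg
    obtain ⟨x, hx⟩ := cauchySeq_tendsto_of_complete h5
    refine ⟨x, tendsto_nhds_unique h1 ?_, hx⟩
    exact ((B.continuous.tendsto x).comp hx).congr fun k => h.apply_coord (s k)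
  · rintro ⟨x, rfl, hx⟩
    have h1 : Tendsto (fun k => (s k : H)) atTop (𝓝 (B x)) :=
      ((B.continuous.tendsto x).comp hx).congr fun k => h.apply_coord (s k)
    refine ⟨h1, ?_⟩
    have h2 := cauchySeq_iff_tendsto_dist_atTop_0.1 h1.cauchySeq
    have h3 := cauchySeq_iff_tendsto_dist_atTop_0.1 hx.cauchySeq
    have h4 := (Complex.continuous_ofReal.tendsto _).comp
      ((h3.pow 2).add ((h2.pow 2).const_mul t))
    simp only [ne_eq, OfNat.ofNat_ne_zero, not_false_eq_true, zero_pow, mul_zero, add_zero,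
      Complex.ofReal_zero] at h4
    exact h4.congr fun p => (hinner p).symm

theorem exists_tendsto_coord (h : IsResolventSqrt A t B) (x : H) :
    ∃ s : ℕ → A.domain, Tendsto (fun k => coord A t B (s k)) atTop (𝓝 x) := by
  obtain ⟨w, hw, hlim⟩ := mem_closure_iff_seq_limit.1 (h.denseRange x)
  choose y hy using hw
  refine ⟨fun k => ⟨(B * B) (y k), h.isResolvent.mem_domain _⟩, hlim.congr fun k => ?_⟩
  exact h.injective (by rw [h.apply_coord, ← hy]; rfl)

theorem mem_formDomain_iff (h : IsResolventSqrt A t B) {u : H} :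
    u ∈ formDomain A ↔ ∃ x, u = B x := by
  constructor
  · rintro ⟨s, hs⟩
    obtain ⟨x, hx, -⟩ := h.formConverges_iff.1 hs
    exact ⟨x, hx⟩
  · rintro ⟨x, rfl⟩
    obtain ⟨s, hs⟩ := h.exists_tendsto_coord x
    exact ⟨s, h.formConverges_iff.2 ⟨x, rfl, hs⟩⟩

theorem form_apply (h : IsResolventSqrt A t B) (hA : IsSelfAdjoint A) (hsb : IsSemibounded A)
    (x y : H) : form A (B x) (B y) = inner ℂ y x + t * inner ℂ (B y) (B x) := by
  obtain ⟨s, hs⟩ := h.exists_tendsto_coord x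
  obtain ⟨r, hr⟩ := h.exists_tendsto_coord y
  have hs' := h.formConverges_iff.2 ⟨x, rfl, hs⟩
  have hr' := h.formConverges_iff.2 ⟨y, rfl, hr⟩
  refine IsFormValue.form_eq hA hsb ⟨s, r, hs', hr', ?_⟩
  refine ((hr.inner (𝕜 := ℂ) hs).add ((hr'.1.inner (𝕜 := ℂ) hs'.1).const_mul (t : ℂ))).congr
    fun k => (h.inner_map (s k) (r k)).symm

theorem formNorm_apply (h : IsResolventSqrt A t B) (hA : IsSelfAdjoint A)
    (hsb : IsSemibounded A) (x : H) :
    formNorm A (B x) = Real.sqrt (‖x‖ ^ 2 - (specMin A - 1 - t) * ‖B x‖ ^ 2) := by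
  rw [formNorm, h.form_apply hA hsb, inner_self_eq_norm_sq_to_K, inner_self_eq_norm_sq_to_K]
  congr 1
  have : (((‖x‖ : ℝ) : ℂ) ^ 2 + t * ((‖B x‖ : ℝ) : ℂ) ^ 2).re = ‖x‖ ^ 2 + t * ‖B x‖ ^ 2 := by
    norm_cast
  exact (congrArg (· - (specMin A - 1) * ‖B x‖ ^ 2) this).trans (by ring)

theorem formNorm_le (h : IsResolventSqrt A t B) (hA : IsSelfAdjoint A) (hsb : IsSemibounded A)
    (ht : t ≤ specMin A - 1) (x : H) : formNorm A (B x) ≤ ‖x‖ := by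
  rw [h.formNorm_apply hA hsb]
  refine Real.sqrt_le_left (norm_nonneg x) |>.2 ?_
  nlinarith [mul_nonneg (sub_nonneg.2 ht) (sq_nonneg ‖B x‖)]

theorem norm_apply_sq_le (h : IsResolventSqrt A t B) (hA : IsSelfAdjoint A) (ht : t < specMin A)
    (hres : ∀ x : ℝ, x < specMin A → (x : ℂ) ∈ resolventSet A) (x : H) :
    ‖B x‖ ^ 2 ≤ (specMin A - t)⁻¹ * ‖x‖ ^ 2 := by
  have hsa : IsSelfAdjoint (B * B) := h.isResolvent.isSelfAdjoint (isFormalAdjoint_self hA)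
  have hpos : 0 ≤ (specMin A - t)⁻¹ := inv_nonneg.2 (sub_pos.2 ht).le
  have hnorm : ‖B * B‖ ≤ (specMin A - t)⁻¹ := by
    rw [← cfc_id' ℝ (B * B)]
    refine norm_cfc_le hpos fun y hy => ?_
    have := h.isResolvent.spectrum_subset ht hres hy
    rw [Real.norm_eq_abs, abs_of_nonneg this.1]
    exact this.2
  calc ‖B x‖ ^ 2 = ‖inner ℂ x ((B * B) x)‖ := by
        change _ = ‖inner ℂ x (B (B x))‖
        rw [← h.inner_left, inner_self_eq_norm_sq_to_K]; simp
    _ ≤ ‖x‖ * ‖(B * B) x‖ := norm_inner_le_norm _ _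
    _ ≤ ‖x‖ * ((specMin A - t)⁻¹ * ‖x‖) := by
        gcongr; exact ContinuousLinearMap.le_of_opNorm_le _ hnorm x
    _ = _ := by ring

theorem norm_le_formNorm (h : IsResolventSqrt A t B) (hA : IsSelfAdjoint A)
    (hsb : IsSemibounded A) (ht : t ≤ specMin A - 1)
    (hres : ∀ x : ℝ, x < specMin A → (x : ℂ) ∈ resolventSet A) (x : H) :
    ‖x‖ ≤ Real.sqrt (specMin A - t) * formNorm A (B x) := by
  have hpos : 0 < specMin A - t := by linarith
  rw [h.formNorm_apply hA hsb, ← Real.sqrt_mul hpos.le]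
  refine Real.le_sqrt_of_sq_le ?_
  have h1 := h.norm_apply_sq_le hA (by linarith) hres x
  have h2 : (specMin A - t) * ‖B x‖ ^ 2 ≤ ‖x‖ ^ 2 := by
    rwa [inv_mul_eq_div, le_div_iff₀' hpos] at h1
  nlinarith [mul_le_mul_of_nonneg_left h2 (show 0 ≤ specMin A - t - 1 by linarith)]

end IsResolventSqrt

theorem IsResolvent.exists_isResolventSqrt {t : ℝ} {R : H →L[ℂ] H} (hR : IsResolvent A t R)
    (hA : IsSelfAdjoint A) (hpos : ∀ y ∈ _root_.spectrum ℝ R, 0 ≤ y) :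
    ∃ B, IsResolventSqrt A t B ∧ B * B = R := by
  have hsa := hR.isSelfAdjoint (isFormalAdjoint_self hA)
  have h0 : 0 ≤ R := (StarOrderedRing.nonneg_iff_spectrum_nonneg (R := ℝ) R).2 hpos
  have hBB := CFC.sqrt_mul_sqrt_self R h0
  exact ⟨CFC.sqrt R, ⟨.of_nonneg (CFC.sqrt_nonneg R), hBB.symm ▸ hR⟩, hBB⟩

end Galerkin

/-! ### Galerkin subspaces and compressions of the resolvent -/

namespace Galerkin

theorem mem_eigenspace_iff {H : Type*} [NormedAddCommGroup H] [InnerProductSpace ℂ H]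
    {A : H →ₗ.[ℂ] H} {z : ℂ} {x : H} :
    x ∈ eigenspace A z ↔ ∃ u : A.domain, (u : H) = x ∧ A u = z • (u : H) := by
  simp only [eigenspace, Submodule.mem_map, LinearMap.mem_ker, LinearMap.sub_apply,
    LinearMap.smul_apply, Submodule.subtype_apply, sub_eq_zero]
  exact exists_congr fun u => and_comm

/-- The map `μ ↦ (μ - t)⁻¹` exchanges `[a, b]` and `[(b - t)⁻¹, (a - t)⁻¹]`. -/
theorem inv_sub_mem_Icc {a b t μ : ℝ} (hta : t < a) (hμ : μ ∈ Set.Icc a b) :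
    (μ - t)⁻¹ ∈ Set.Icc (b - t)⁻¹ (a - t)⁻¹ :=
  ⟨inv_anti₀ (by linarith [hμ.1]) (by linarith [hμ.2]),
    inv_anti₀ (by linarith) (by linarith [hμ.1])⟩

theorem add_inv_mem_Icc {a b t τ : ℝ} (htb : t < b)
    (hτ : τ ∈ Set.Icc (b - t)⁻¹ (a - t)⁻¹) : t + τ⁻¹ ∈ Set.Icc a b := by
  have hb : 0 < (b - t)⁻¹ := inv_pos.2 (sub_pos.2 htb)
  have h1 := inv_anti₀ (hb.trans_le hτ.1) hτ.2
  have h2 := inv_anti₀ hb hτ.1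
  rw [inv_inv] at h1 h2
  exact ⟨by linarith, by linarith⟩

theorem IsResolvent.eigenSpan_eq {H : Type*} [NormedAddCommGroup H] [InnerProductSpace ℂ H]
    {A : H →ₗ.[ℂ] H} {t a b : ℝ} {R : H →L[ℂ] H} (h : IsResolvent A t R) (hta : t < a)
    (htb : t < b) :
    eigenSpan R (b - t)⁻¹ (a - t)⁻¹ = ⨆ μ ∈ Set.Icc a b, eigenspace A (μ : ℂ) := by
  apply le_antisymm
  · refine eigenSpan_le fun τ hτ x hx => ?_
    have hμ := add_inv_mem_Icc htb hτ
    refine le_iSup₂_of_le (f := fun (μ : ℝ) (_ : μ ∈ Set.Icc a b) => eigenspace A (μ : ℂ))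
      (t + τ⁻¹) hμ le_rfl (mem_eigenspace_iff.2 (h.apply_of_eigenvector ?_ ?_))
    · exact_mod_cast (hta.trans_le hμ.1).ne'
    · rw [hx]; push_cast; rw [add_sub_cancel_left, inv_inv]
  · refine iSup₂_le fun μ hμ x hx => ?_
    obtain ⟨u, rfl, hu⟩ := mem_eigenspace_iff.1 hx
    refine mem_eigenSpan (inv_sub_mem_Icc hta hμ) ?_
    rw [h.map_eigenvector (by exact_mod_cast (hta.trans_le hμ.1).ne') hu]
    push_cast
    rfl

theorem IsResolvent.spectralProjection_eq {H : Type*} [NormedAddCommGroup H]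
    [InnerProductSpace ℂ H] [CompleteSpace H]
    {A : H →ₗ.[ℂ] H} {t a b : ℝ} {R : H →L[ℂ] H} (h : IsResolvent A t R) (hta : t < a)
    (htb : t < b) (hR : IsSelfAdjoint R) (hiso : FinitelyManyIsolated R (b - t)⁻¹ (a - t)⁻¹) :
    spectralProjection A a b = cfc ((Set.Icc (b - t)⁻¹ (a - t)⁻¹).indicator 1) R := by
  have e := h.eigenSpan_eq hta htb
  refine starProjection_eq_cfc_indicator hR hiso ?_ ?_
  · rw [e]; exact Submodule.le_topologicalClosure _
  · rw [e]; exact le_rfl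

/-- The compression `P R P` of `R` to the subspace `M`, where `P` is the orthogonal projection onto
`M`, as an operator on the whole space. -/
noncomputable def compression {H : Type*} [NormedAddCommGroup H] [InnerProductSpace ℂ H]
    (R : H →L[ℂ] H) (M : Submodule ℂ H) [M.HasOrthogonalProjection] : H →L[ℂ] H :=
  M.starProjection * R * M.starProjection

section Compression

variable {H : Type*} [NormedAddCommGroup H] [InnerProductSpace ℂ H] {R : H →L[ℂ] H}

theorem compression_apply_mem (M : Submodule ℂ H) [M.HasOrthogonalProjection] (x : H) :
    compression R M x ∈ M := M.starProjection_apply_mem _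

theorem compression_apply_of_mem {M : Submodule ℂ H} [M.HasOrthogonalProjection] {x : H}
    (hx : x ∈ M) : compression R M x = M.starProjection (R x) :=
  congrArg (fun y => M.starProjection (R y)) (M.starProjection_eq_self_iff.2 hx)

theorem isSelfAdjoint_compression [CompleteSpace H] (hR : IsSelfAdjoint R) (M : Submodule ℂ H)
    [M.HasOrthogonalProjection] : IsSelfAdjoint (compression R M) := by
  rw [ContinuousLinearMap.isSelfAdjoint_iff_isSymmetric] at hR ⊢
  intro x y
  change inner ℂ (M.starProjection (R (M.starProjection x))) y
    = inner ℂ x (M.starProjection (R (M.starProjection y)))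
  rw [M.inner_starProjection_left_eq_right, ← M.inner_starProjection_left_eq_right x]
  exact hR _ _

theorem norm_compression_le (M : Submodule ℂ H) [M.HasOrthogonalProjection] :
    ‖compression R M‖ ≤ ‖R‖ := by
  have h1 := M.starProjection_norm_le
  calc ‖compression R M‖ ≤ ‖M.starProjection‖ * ‖R‖ * ‖M.starProjection‖ :=
        (norm_mul_le _ _).trans (by gcongr; exact norm_mul_le _ _)
    _ ≤ 1 * ‖R‖ * 1 := by gcongr
    _ = ‖R‖ := by ring

theorem eigenSpan_compression_le {M : Submodule ℂ H} [M.HasOrthogonalProjection] {α β : ℝ}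
    (hα : 0 < α) : eigenSpan (compression R M) α β ≤ M := by
  refine eigenSpan_le fun τ hτ x hx => ?_
  have h0 : (τ : ℂ) ≠ 0 := by exact_mod_cast (hα.trans_le hτ.1).ne'
  have h1 : x = (τ : ℂ)⁻¹ • compression R M x := by rw [hx, inv_smul_smul₀ h0]
  rw [h1]
  exact M.smul_mem _ (compression_apply_mem M x)

theorem map_mem_eigenSpan {T : H →L[ℂ] H} {α β : ℝ} {x : H} (hx : x ∈ eigenSpan T α β) :
    T x ∈ eigenSpan T α β := by
  have hle : eigenSpan T α β ≤ (eigenSpan T α β).comap (T : H →ₗ[ℂ] H) :=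
    eigenSpan_le fun τ hτ y hy => by
      change T y ∈ eigenSpan T α β
      rw [hy]
      exact Submodule.smul_mem _ _ (mem_eigenSpan hτ hy)
  exact hle hx

end Compression

namespace IsResolventSqrt

variable {H : Type*} [NormedAddCommGroup H] [InnerProductSpace ℂ H] [CompleteSpace H]
  {A : H →ₗ.[ℂ] H} {t a b : ℝ} {B : H →L[ℂ] H}

theorem finiteDimensional_comap (h : IsResolventSqrt A t B) (L : Submodule ℂ H)
    [FiniteDimensional ℂ L] : FiniteDimensional ℂ (L.comap (B : H →ₗ[ℂ] H)) :=
  FiniteDimensional.of_injective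
    ((B : H →ₗ[ℂ] H).restrict (p := L.comap (B : H →ₗ[ℂ] H)) (q := L) fun _ hx => hx)
    fun _ _ hxy => Subtype.ext (h.injective (congrArg Subtype.val hxy))

/-- `B` carries the eigenvectors of the compression of `(A - t)⁻¹` to `B⁻¹ L` to the Galerkin
eigenvectors in `L`. -/
theorem galerkinSubspace_eq (h : IsResolventSqrt A t B) (hA : IsSelfAdjoint A)
    (hsb : IsSemibounded A) (hta : t < a) (htb : t < b) {L : Submodule ℂ H}
    (hL : (L : Set H) ⊆ formDomain A) [(L.comap (B : H →ₗ[ℂ] H)).HasOrthogonalProjection] :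
    galerkinSubspace A L a b = (eigenSpan (compression (B * B) (L.comap (B : H →ₗ[ℂ] H)))
      (b - t)⁻¹ (a - t)⁻¹).map (B : H →ₗ[ℂ] H) := by
  set M := L.comap (B : H →ₗ[ℂ] H) with hM
  have hb : 0 < (b - t)⁻¹ := inv_pos.2 (sub_pos.2 htb)
  -- the Galerkin eigenvalue equation, pulled back by `B`
  have key : ∀ x y : H, ∀ μ : ℝ, form A (B x) (B y) = (μ : ℂ) * inner ℂ (B y) (B x) ↔
      inner ℂ y x = ((μ : ℂ) - t) * inner ℂ y ((B * B) x) := fun x y μ => by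
    have e : inner ℂ (B y) (B x) = inner ℂ y ((B * B) x) := h.inner_left y (B x)
    rw [h.form_apply hA hsb, e]
    constructor
    · intro h'; linear_combination h'
    · intro h'; linear_combination h'
  apply le_antisymm
  · refine Submodule.span_le.2 ?_
    rintro u ⟨huL, μ, hμ, hu⟩
    obtain ⟨x, rfl⟩ := h.mem_formDomain_iff.1 (hL huL)
    have hne : (μ : ℂ) - t ≠ 0 := sub_ne_zero.2 (by exact_mod_cast (hta.trans_le hμ.1).ne')
    refine ⟨x, mem_eigenSpan (inv_sub_mem_Icc hta hμ) ?_, rfl⟩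
    have hxM : x ∈ M := huL
    rw [compression_apply_of_mem hxM]
    refine Submodule.eq_starProjection_of_mem_of_inner_eq_zero (M.smul_mem _ hxM) fun y hy => ?_
    have h' := (key x y μ).1 (hu (B y) hy)
    rw [← inner_conj_symm, inner_sub_right, inner_smul_right, h', Complex.ofReal_inv,
      Complex.ofReal_sub, inv_mul_cancel_left₀ hne, sub_self, map_zero]
  · rw [Submodule.map_le_iff_le_comap]
    refine eigenSpan_le fun τ hτ x hx => Submodule.subset_span ?_
    have hxM : x ∈ M := eigenSpan_compression_le hb (mem_eigenSpan hτ hx)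
    refine ⟨hxM, t + τ⁻¹, add_inv_mem_Icc htb hτ, fun v hv => ?_⟩
    obtain ⟨y, rfl⟩ := h.mem_formDomain_iff.1 (hL hv)
    refine (key x y _).2 ?_
    have h0 : (τ : ℂ) ≠ 0 := by exact_mod_cast (hb.trans_le hτ.1).ne'
    have hyM : y ∈ M := hv
    have h1 : inner ℂ y ((B * B) x) = (τ : ℂ) * inner ℂ y x := by
      rw [← inner_smul_right, ← hx, compression_apply_of_mem hxM,
        ← M.inner_starProjection_left_eq_right, M.starProjection_eq_self_iff.2 hyM]
    rw [h1]
    push_cast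
    rw [add_sub_cancel_left, inv_mul_cancel_left₀ h0]

/-- Up to an error controlled by the distance of `x` to `B⁻¹ L` the Galerkin projection, pulled back
by `B`, is the spectral projection of the compression of `(A - t)⁻¹` to `B⁻¹ L`. The projections
agree on `B⁻¹ L`, because eigenvectors of the compression are orthogonal for both inner products. -/
theorem exists_galerkinProjection_apply (h : IsResolventSqrt A t B) (hA : IsSelfAdjoint A)
    (hsb : IsSemibounded A) (hta : t < a) (htb : t < b) {L : Submodule ℂ H}
    [FiniteDimensional ℂ L]
    (hL : (L : Set H) ⊆ formDomain A) [FiniteDimensional ℂ (L.comap (B : H →ₗ[ℂ] H))] (x : H) :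
    ∃ z, galerkinProjection A L a b (B x)
        = B (cfc ((Set.Icc (b - t)⁻¹ (a - t)⁻¹).indicator 1)
          (compression (B * B) (L.comap (B : H →ₗ[ℂ] H))) x + z) ∧
      ‖z‖ ≤ (b - t) * ‖B‖ * ‖B (x - (L.comap (B : H →ₗ[ℂ] H)).starProjection x)‖ := by
  have hG := h.galerkinSubspace_eq hA hsb hta htb hL
  set M := L.comap (B : H →ₗ[ℂ] H) with hM
  set T := compression (B * B) M with hTdef
  set F := eigenSpan T (b - t)⁻¹ (a - t)⁻¹ with hF
  have hb : 0 < (b - t)⁻¹ := inv_pos.2 (sub_pos.2 htb)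
  have hFM : F ≤ M := eigenSpan_compression_le hb
  have : FiniteDimensional ℂ F := Submodule.finiteDimensional_of_le hFM
  have hT : IsSelfAdjoint T :=
    isSelfAdjoint_compression (h.isResolvent.isSelfAdjoint (isFormalAdjoint_self hA)) M
  have hiso : FinitelyManyIsolated T (b - t)⁻¹ (a - t)⁻¹ :=
    .of_finite (finite_spectrum_of_range_le (M := M) (compression_apply_mem M))
  rw [← starProjection_eq_cfc_indicator hT hiso (K := F) le_rfl (Submodule.le_topologicalClosure _)]
  -- on `M` the two projections agree
  have h1 : galerkinProjection A L a b (B (M.starProjection x)) = B (F.starProjection x) := by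
    refine Submodule.eq_starProjection_of_mem_of_inner_eq_zero ?_ ?_
    · rw [hG]; exact ⟨_, F.starProjection_apply_mem x, rfl⟩
    · rw [hG]
      rintro _ ⟨f, hf, rfl⟩
      have e : M.starProjection x - F.starProjection x
          = M.starProjection (x - F.starProjection x) := by
        rw [map_sub, M.starProjection_eq_self_iff.2 (hFM (F.starProjection_apply_mem x))]
      change inner ℂ (B (M.starProjection x) - B (F.starProjection x)) (B f) = 0
      rw [← map_sub, h.inner_left, e, M.inner_starProjection_left_eq_right]
      have e' : M.starProjection (B (B f)) = T f :=
        (compression_apply_of_mem (R := B * B) (hFM hf)).symm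
      rw [e']
      exact F.starProjection_inner_eq_zero _ _ (map_mem_eigenSpan hf)
  obtain ⟨z, hz, hz'⟩ : galerkinProjection A L a b (B (x - M.starProjection x)) ∈
      F.map (B : H →ₗ[ℂ] H) := hG ▸ Submodule.starProjection_apply_mem _ _
  change B z = _ at hz'
  refine ⟨z, ?_, ?_⟩
  · rw [map_add, hz', ← h1, ← map_add, ← map_add, add_sub_cancel]
  · calc ‖z‖ ≤ (b - t) * ‖T z‖ := by simpa using norm_le_of_mem_eigenSpan hT hiso hb hz
      _ ≤ (b - t) * (‖B‖ * ‖B z‖) := by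
        have := (sub_pos.2 htb).le
        gcongr
        rw [hTdef, compression_apply_of_mem (hFM hz)]
        exact (M.norm_starProjection_apply_le _).trans (B.le_opNorm (B z))
      _ ≤ (b - t) * (‖B‖ * ‖B (x - M.starProjection x)‖) := by
        have := (sub_pos.2 htb).le
        gcongr
        rw [hz']
        exact Submodule.norm_starProjection_apply_le _ _
      _ = _ := by ring

end IsResolventSqrt

theorem tendsto_starProjection {H : Type*} [NormedAddCommGroup H] [InnerProductSpace ℂ H]
    {M : ℕ → Submodule ℂ H} [∀ n, (M n).HasOrthogonalProjection] {x : H} {y : ℕ → H}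
    (hy : ∀ n, y n ∈ M n) (hlim : Tendsto (fun n => ‖x - y n‖) atTop (𝓝 0)) :
    Tendsto (fun n => (M n).starProjection x) atTop (𝓝 x) := by
  rw [tendsto_iff_norm_sub_tendsto_zero]
  have h2 := hlim.add hlim
  rw [add_zero] at h2
  refine squeeze_zero (fun _ => norm_nonneg _) (fun n => ?_) h2
  have e : (M n).starProjection x - x = (M n).starProjection (x - y n) - (x - y n) := by
    rw [map_sub, (M n).starProjection_eq_self_iff.2 (hy n)]; abel
  rw [e]
  exact (norm_sub_le _ _).trans
    (add_le_add ((M n).norm_starProjection_apply_le _) le_rfl)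

theorem tendsto_compression {H : Type*} [NormedAddCommGroup H] [InnerProductSpace ℂ H]
    {M : ℕ → Submodule ℂ H} [∀ n, (M n).HasOrthogonalProjection]
    (hM : ∀ x, Tendsto (fun n => (M n).starProjection x) atTop (𝓝 x)) (R : H →L[ℂ] H) (x : H) :
    Tendsto (fun n => compression R (M n) x) atTop (𝓝 (R x)) := by
  have h1 : Tendsto (fun n => (M n).starProjection (R ((M n).starProjection x - x))) atTop
      (𝓝 0) := by
    have h2 := (R.continuous.tendsto _).comp ((hM x).sub_const x)
    rw [sub_self, map_zero] at h2
    exact squeeze_zero_norm (fun n => (M n).norm_starProjection_apply_le _) (by simpa using h2.norm)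
  have h3 := h1.add (hM (R x))
  rw [zero_add] at h3
  refine h3.congr fun n => ?_
  rw [← map_add, ← map_add, sub_add_cancel]
  rfl

end Galerkin

/-! ### Convergence of the Galerkin projections -/

theorem mainTheorem2 {H : Type*} [NormedAddCommGroup H] [InnerProductSpace ℂ H] [CompleteSpace H]
    (A : H →ₗ.[ℂ] H) (hA : IsSelfAdjoint A) (hsb : Galerkin.IsSemibounded A)
    (a b : ℝ) (hab : a < b)
    (ha : (a : ℂ) ∈ Galerkin.resolventSet A) (hb : (b : ℂ) ∈ Galerkin.resolventSet A)
    (hess : ∀ x ∈ Set.Icc a b, (x : ℂ) ∉ Galerkin.essentialSpectrum A)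
    (L : ℕ → Submodule ℂ H) [∀ n, FiniteDimensional ℂ (L n)]
    (hL : ∀ n, (L n : Set H) ⊆ Galerkin.formDomain A)
    (hdense : ∀ u ∈ Galerkin.formDomain A, ∃ w : ℕ → H, (∀ n, w n ∈ L n) ∧
      Tendsto (fun n => Galerkin.formNorm A (u - w n)) atTop (𝓝 0))
    (u : H) (hu : u ∈ Galerkin.formDomain A) :
    (∀ n, Galerkin.galerkinProjection A (L n) a b u - Galerkin.spectralProjection A a b u
      ∈ Galerkin.formDomain A) ∧
    Tendsto (fun n => Galerkin.formNorm A
      (Galerkin.galerkinProjection A (L n) a b u - Galerkin.spectralProjection A a b u))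
      atTop (𝓝 0) := by

  have hres : ∀ x : ℝ, x < Galerkin.specMin A → (x : ℂ) ∈ Galerkin.resolventSet A := fun x hx =>
    Galerkin.mem_resolventSet_of_lt_specMin hA hsb ha hx
  -- a point `t` to the left of `Δ` for which `A - t ≥ 1`; then `μ ↦ (μ - t)⁻¹` is decreasing on
  -- `Δ`, also if `Δ` reaches below the spectrum
  obtain ⟨t, htm, hta⟩ : ∃ t, t ≤ Galerkin.specMin A - 1 ∧ t < a :=
    ⟨min (Galerkin.specMin A) a - 1, by linarith [min_le_left (Galerkin.specMin A) a],
      by linarith [min_le_right (Galerkin.specMin A) a]⟩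
  have htb : t < b := hta.trans hab
  have htm' : t < Galerkin.specMin A := by linarith
  obtain ⟨R, hR⟩ := Galerkin.mem_resolventSet_iff.1 (hres t htm')
  have hRsa := hR.isSelfAdjoint (Galerkin.isFormalAdjoint_self hA)
  obtain ⟨B, hB, rfl⟩ := hR.exists_isResolventSqrt hA fun y hy =>
    (hR.spectrum_subset htm' hres hy).1
  have hα : (b - t)⁻¹ ∉ spectrum ℝ (B * B) := hR.notMem_spectrum hb htb.ne'
  have hβ : (a - t)⁻¹ ∉ spectrum ℝ (B * B) := hR.notMem_spectrum ha hta.ne'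
  have hiso : FinitelyManyIsolated (B * B) (b - t)⁻¹ (a - t)⁻¹ := by
    refine .of_isolated hα hβ fun τ hτ hτ' => ?_
    have hpos : 0 < τ := (inv_pos.2 (sub_pos.2 htb)).trans_le hτ'.1
    refine hR.eventually_notMem_spectrum hpos ?_
    by_contra hd
    refine hess _ (Galerkin.add_inv_mem_Icc htb hτ') ⟨fun hρ => ?_, hd⟩
    have h := hR.notMem_spectrum hρ (by simpa using hpos.ne')
    rw [add_sub_cancel_left, inv_inv] at h
    exact h hτ
  have hE := hR.spectralProjection_eq hta htb hRsa hiso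
  set χ : ℝ → ℝ := (Set.Icc (b - t)⁻¹ (a - t)⁻¹).indicator 1 with hχ
  have hcomm : ∀ x, Galerkin.spectralProjection A a b (B x) = B (cfc χ (B * B) x) := fun x => by
    rw [hE]
    have h : Commute (cfc χ (B * B)) B := ((Commute.refl B).mul_left (Commute.refl B)).cfc_real χ
    exact congrArg (fun S : H →L[ℂ] H => S x) h.eq
  have : ∀ n, FiniteDimensional ℂ ((L n).comap (B : H →ₗ[ℂ] H)) := fun n =>
    hB.finiteDimensional_comap (L n)
  -- density of the trial spaces, pulled back by `B`
  have hP : ∀ x, Tendsto (fun n => ((L n).comap (B : H →ₗ[ℂ] H)).starProjection x) atTop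
      (𝓝 x) := fun x => by
    obtain ⟨w, hw, hlim⟩ := hdense (B x) (hB.mem_formDomain_iff.2 ⟨x, rfl⟩)
    choose y hy using fun n => hB.mem_formDomain_iff.1 (hL n (hw n))
    refine Galerkin.tendsto_starProjection (y := y) (fun n => ?_) ?_
    · change B (y n) ∈ L n
      exact hy n ▸ hw n
    · have h := hlim.const_mul (Real.sqrt (Galerkin.specMin A - t))
      rw [mul_zero] at h
      refine squeeze_zero (fun _ => norm_nonneg _) (fun n => ?_) h
      rw [hy n, ← map_sub]
      exact hB.norm_le_formNorm hA hsb htm hres _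
  obtain ⟨x, rfl⟩ := hB.mem_formDomain_iff.1 hu
  choose z hz hz' using fun n => hB.exists_galerkinProjection_apply hA hsb hta htb (hL n) x
  have hdiff : ∀ n, Galerkin.galerkinProjection A (L n) a b (B x)
      - Galerkin.spectralProjection A a b (B x)
      = B (cfc χ (Galerkin.compression (B * B) ((L n).comap (B : H →ₗ[ℂ] H))) x + z n
        - cfc χ (B * B) x) := fun n => by
    rw [hz n, hcomm, ← map_sub]
  refine ⟨fun n => hB.mem_formDomain_iff.2 ⟨_, hdiff n⟩, ?_⟩
  have hS := tendsto_cfc_indicator_apply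
    (fun n => Galerkin.isSelfAdjoint_compression hRsa ((L n).comap (B : H →ₗ[ℂ] H))) hRsa
    (fun n => Galerkin.norm_compression_le _) le_rfl (Galerkin.tendsto_compression hP (B * B))
    (fun n => finite_spectrum_of_range_le (Galerkin.compression_apply_mem _)) hα hβ x
  have hz0 : Tendsto z atTop (𝓝 0) := by
    have h := ((B.continuous.tendsto _).comp ((hP x).const_sub x)).norm.const_mul ((b - t) * ‖B‖)
    rw [sub_self, map_zero, norm_zero, mul_zero] at h
    exact squeeze_zero_norm hz' h
  have h0 := ((hS.add hz0).sub_const (cfc χ (B * B) x)).norm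
  rw [add_zero, sub_self, norm_zero] at h0
  refine squeeze_zero (fun _ => Real.sqrt_nonneg _) (fun n => ?_) h0
  rw [hdiff n]
  exact hB.formNorm_le hA hsb htm _
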